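/- Let $\mathbb{D}$ be the open unit disk and $dA$ the normalized area measure on $\mathbb{D}$. For real $\beta$ put $dA_\beta(z)=c_\beta(1-|z|^2)^\beta\,dA(z)$, with $c_\beta=\beta+1$ if $\beta>-1$ (so that $A_\beta(\mathbb{D})=1$) and $c_\beta=1$ otherwise, and let $A^2_\beta$ be the space of all analytic functions $f$ on $\mathbb{D}$ with $$\int_{\mathbb{D}}(1-|z|^2)^{2k}\,|f^{(k)}(z)|^2\,dA_\beta(z)<\infty,$$ where $k$ is the least non-negative integer with $2k+\beta>-1$ (any other such $k$ gives the same space). For $\beta>-1$ we have $k=0$, and $A^2_\beta$ is a Hilbert space as a closed subspace of $L^2(\mathbb{D},dA_\beta)$. Let $\alpha>-1$ and let $\varphi$ be an analytic function on $\mathbb{D}$ with $|\varphi|\le 1$ that is not a constant of modulus $1$. Let $T_\varphi f=\varphi f$ be the (contractive) multiplication operator on $A^2_\alpha$, let $D^\alpha_\varphi=(I-T_\varphi T_\varphi^*)^{1/2}$ be its defect operator (positive square root), and let $H^\alpha(\varphi)=D^\alpha_\varphi(A^2_\alpha)$ be the range of $D^\alpha_\varphi$. Then the following conditions are equivalent.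 (a) The operator $D^\alpha_\varphi$ is compact on $A^2_\alpha$. (b) $\varphi$ is a finite Blaschke product, that is, $\varphi(z)=c\prod_{i=1}^n\frac{a_i-z}{1-\overline{a_i}z}$ on $\mathbb{D}$ for some integer $n\ge0$, some $a_1,\dots,a_n\in\mathbb{D}$ and some $c\in\mathbb{C}$ with $|c|=1$. (c) $H^\alpha(\varphi)=A^2_{\alpha-1}$ (as sets of functions). (d) $H^\alpha(\varphi)\subseteq A^2_{\alpha-1}$. -/

import Mathlib

open MeasureTheory Set Filter Topology
open scoped ENNReal NNReal ComplexConjugate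

namespace SubBergman

/-- The open unit disk in the complex plane. -/
abbrev disk : Set ℂ := Metric.ball (0 : ℂ) 1

/-- The constant in front of `(1 - |z|²)^β dA(z)`, where `dA` is normalized area measure on the
disk. For `β > -1` it makes `dA_β` a probability measure; otherwise there is no normalization. -/
noncomputable def normConst (β : ℝ) : ℝ := if -1 < β then β + 1 else 1

/-- The density of `dA_β` with respect to Lebesgue measure on the disk. -/
noncomputable def weight (β : ℝ) (z : ℂ) : ℝ :=
  normConst β / Real.pi * (1 - ‖z‖ ^ 2) ^ β

/-- The weighted area measure `dA_β` on the unit disk, as a measure on `ℂ`. -/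
noncomputable def areaMeasure (β : ℝ) : Measure ℂ :=
  (volume.restrict disk).withDensity fun z => ENNReal.ofReal (weight β z)

/-! ### The Hilbert space `A²_α` as a closed subspace of `L²(dA_α)` -/

theorem ae_mem_disk (β : ℝ) : ∀ᵐ z ∂areaMeasure β, z ∈ disk :=
  (withDensity_absolutelyContinuous _ _).ae_le (ae_restrict_mem measurableSet_ball)

theorem aestronglyMeasurable_of_differentiableOn (β : ℝ) {g : ℂ → ℂ}
    (hg : DifferentiableOn ℂ g disk) : AEStronglyMeasurable g (areaMeasure β) :=
  (hg.continuousOn.aestronglyMeasurable measurableSet_ball).mono_ac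
    (withDensity_absolutelyContinuous _ _)

/-- The elements of `L²(dA_α)` that are represented by an analytic function on the disk. -/
noncomputable def bergman (α : ℝ) : Submodule ℂ (Lp ℂ 2 (areaMeasure α)) where
  carrier := {f | ∃ g : ℂ → ℂ, DifferentiableOn ℂ g disk ∧ f =ᵐ[areaMeasure α] g}
  zero_mem' := ⟨fun _ => 0, differentiableOn_const _, Lp.coeFn_zero _ _ _⟩
  add_mem' := by
    rintro f₁ f₂ ⟨g₁, h₁, e₁⟩ ⟨g₂, h₂, e₂⟩
    exact ⟨g₁ + g₂, h₁.add h₂, (Lp.coeFn_add f₁ f₂).trans (e₁.add e₂)⟩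
  smul_mem' := by
    rintro c f ⟨g, h, e⟩
    exact ⟨c • g, h.const_smul c, (Lp.coeFn_smul c f).trans (e.const_smul c)⟩

theorem circle_lower_bound {g : ℂ → ℂ} {z : ℂ} {R r : ℝ}
    (hg : DifferentiableOn ℂ g (Metric.ball z R)) (hr : 0 < r) (hrR : r < R) :
    ENNReal.ofReal (2 * Real.pi) * ‖g z‖ₑ ≤
      ∫⁻ θ in Ioo (-Real.pi) Real.pi, ‖g (z + r * (Real.cos θ + Real.sin θ * Complex.I))‖ₑ := by
  have hcl : DiffContOnCl ℂ g (Metric.ball z |r|) := by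
    rw [abs_of_pos hr]
    exact (hg.mono (Metric.closedBall_subset_ball hrR)).diffContOnCl_ball subset_rfl
  have h1 := hcl.circleAverage
  rw [Real.circleAverage_def] at h1
  have hper : Function.Periodic (fun θ => g (circleMap z r θ)) (2 * Real.pi) := fun θ => by
    simp only [(periodic_circleMap z r) θ]
  have h2 : ∫ θ in (0 : ℝ)..2 * Real.pi, g (circleMap z r θ) =
      ∫ θ in Ioc (-Real.pi) Real.pi, g (circleMap z r θ) := by
    have := hper.intervalIntegral_add_eq 0 (-Real.pi)
    rw [zero_add] at this
    rw [this, intervalIntegral.integral_of_le (by linarith [Real.pi_pos])]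
    congr 3
    ring
  have hmap : ∀ θ : ℝ, circleMap z r θ = z + r * (Real.cos θ + Real.sin θ * Complex.I) := by
    intro θ
    rw [circleMap, Complex.exp_mul_I, Complex.ofReal_cos, Complex.ofReal_sin]
  have h3 : ((2 * Real.pi : ℝ) : ℂ) * g z =
      ∫ θ in Ioc (-Real.pi) Real.pi, g (circleMap z r θ) := by
    rw [← h2, ← h1, Complex.real_smul, ← mul_assoc, ← Complex.ofReal_mul,
      mul_inv_cancel₀ (by positivity), Complex.ofReal_one, one_mul]
  calc ENNReal.ofReal (2 * Real.pi) * ‖g z‖ₑ = ‖((2 * Real.pi : ℝ) : ℂ) * g z‖ₑ := by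
        rw [enorm_mul]
        congr 1
        rw [← ofReal_norm, Complex.norm_real, Real.norm_of_nonneg (by positivity)]
    _ ≤ ∫⁻ θ in Ioc (-Real.pi) Real.pi, ‖g (circleMap z r θ)‖ₑ := by
        rw [h3]
        exact enorm_integral_le_lintegral_enorm _
    _ = _ := by
        rw [setLIntegral_congr Ioo_ae_eq_Ioc.symm]
        simp only [hmap]

theorem area_lower_bound {g : ℂ → ℂ} {z : ℂ} {R : ℝ} (hR : 0 < R)
    (hg : DifferentiableOn ℂ g (Metric.ball z R)) :
    ENNReal.ofReal (Real.pi * R ^ 2 / 2) * ‖g z‖ₑ ≤ ∫⁻ w in Metric.ball z R, ‖g w‖ₑ := by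
  set F : ℂ → ℝ≥0∞ := (Metric.ball (0 : ℂ) R).indicator fun w => ‖g (z + w)‖ₑ with hF
  have hcont : ContinuousOn (fun w => g (z + w)) (Metric.ball (0 : ℂ) R) := by
    refine hg.continuousOn.comp (by fun_prop) ?_
    intro w hw
    simpa using hw
  have hFm : Measurable F := by
    classical
    have := hcont.enorm.measurable_piecewise (g := (0 : ℂ → ℝ≥0∞)) continuousOn_const
      measurableSet_ball
    rwa [piecewise_eq_indicator] at this
  have hshift : ∫⁻ w in Metric.ball z R, ‖g w‖ₑ = ∫⁻ w, F w := by
    rw [← lintegral_indicator measurableSet_ball, ← lintegral_add_left_eq_self _ z]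
    refine lintegral_congr fun w => ?_
    simp only [hF, indicator, Metric.mem_ball, dist_self_add_left, dist_zero_right]
  rw [hshift, ← Complex.lintegral_comp_polarCoord_symm]
  have htarget : polarCoord.target = Ioi (0 : ℝ) ×ˢ Ioo (-Real.pi) Real.pi := rfl
  have hprod : (volume : Measure (ℝ × ℝ)).restrict polarCoord.target =
      (volume.restrict (Ioi (0 : ℝ))).prod (volume.restrict (Ioo (-Real.pi) Real.pi)) := by
    rw [htarget, Measure.prod_restrict, Measure.volume_eq_prod]
  have hsymm : Measurable fun p : ℝ × ℝ => Complex.polarCoord.symm p := by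
    simp only [Complex.polarCoord_symm_apply]
    fun_prop
  rw [hprod, lintegral_prod _ (by
    simp only [smul_eq_mul]
    exact ((by fun_prop : Measurable fun p : ℝ × ℝ => ENNReal.ofReal p.1).mul
      (hFm.comp hsymm)).aemeasurable)]
  calc ENNReal.ofReal (Real.pi * R ^ 2 / 2) * ‖g z‖ₑ
      = ∫⁻ _ in Ioo (R / 2) R, ENNReal.ofReal (R / 2) * (ENNReal.ofReal (2 * Real.pi) * ‖g z‖ₑ) := by
        rw [setLIntegral_const, Real.volume_Ioo, ← mul_assoc, mul_right_comm,
          ← ENNReal.ofReal_mul (by positivity), ← ENNReal.ofReal_mul (by positivity)]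
        congr 2
        ring
    _ ≤ ∫⁻ r in Ioo (R / 2) R, ∫⁻ θ in Ioo (-Real.pi) Real.pi,
          ENNReal.ofReal r • F (Complex.polarCoord.symm (r, θ)) := by
        refine setLIntegral_mono' measurableSet_Ioo fun r hr => ?_
        have hr0 : 0 < r := by linarith [hr.1]
        simp only [smul_eq_mul]
        rw [lintegral_const_mul' _ _ ENNReal.ofReal_ne_top]
        refine mul_le_mul' (ENNReal.ofReal_le_ofReal hr.1.le) ?_
        refine (circle_lower_bound hg hr0 hr.2).trans (le_of_eq ?_)
        refine lintegral_congr fun θ => ?_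
        have hmem : Complex.polarCoord.symm (r, θ) ∈ Metric.ball (0 : ℂ) R := by
          rw [mem_ball_zero_iff, Complex.norm_polarCoord_symm, abs_of_pos hr0]
          exact hr.2
        rw [hF, indicator_of_mem hmem, Complex.polarCoord_symm_apply]
    _ ≤ _ := lintegral_mono_set fun r hr => lt_trans (by positivity) hr.1

theorem weight_pos (β : ℝ) {z : ℂ} (hz : z ∈ disk) : 0 < weight β z := by
  have h1 : ‖z‖ < 1 := by simpa using hz
  have h2 : 0 < 1 - ‖z‖ ^ 2 := by nlinarith [norm_nonneg z]
  have h3 : 0 < normConst β := by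
    unfold normConst
    split_ifs <;> linarith
  exact mul_pos (div_pos h3 Real.pi_pos) (Real.rpow_pos_of_pos h2 _)

theorem continuousOn_weight (β : ℝ) : ContinuousOn (weight β) disk := by
  refine continuousOn_const.mul (ContinuousOn.rpow_const (by fun_prop) fun z hz => Or.inl ?_)
  have h1 : ‖z‖ < 1 := by simpa using hz
  nlinarith [norm_nonneg z]

/-- Point evaluations are bounded in the norm of `L²(dA_β)`, uniformly on smaller disks. -/
theorem eval_bound (β : ℝ) {ρ : ℝ} (hρ : ρ < 1) :
    ∃ C : ℝ≥0, ∀ g : ℂ → ℂ, DifferentiableOn ℂ g disk → ∀ z : ℂ, ‖z‖ ≤ ρ →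
      ‖g z‖ₑ ≤ C * eLpNorm g 2 (areaMeasure β) := by
  rcases lt_or_ge ρ 0 with h0 | h0
  · exact ⟨0, fun g _ z hz => absurd (norm_nonneg z) (by linarith)⟩
  set s : ℝ := (1 + ρ) / 2 with hs
  have hs1 : s < 1 := by rw [hs]; linarith
  have hR : 0 < (1 - ρ) / 2 := by linarith
  have hK : Metric.closedBall (0 : ℂ) s ⊆ disk := Metric.closedBall_subset_ball hs1
  obtain ⟨w₀, hw₀, hmin⟩ := (isCompact_closedBall (0 : ℂ) s).exists_isMinOn
    (Metric.nonempty_closedBall.2 (by rw [hs]; linarith)) ((continuousOn_weight β).mono hK)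
  set m := weight β w₀ with hm
  have hm0 : 0 < m := weight_pos β (hK hw₀)
  set A : ℝ := m * (Real.pi * ((1 - ρ) / 2) ^ 2 / 2) with hA
  have hA0 : 0 < A := by positivity
  refine ⟨(Real.toNNReal A⁻¹) ^ (1 / 2 : ℝ), fun g hg z hz => ?_⟩
  have hball : Metric.ball z ((1 - ρ) / 2) ⊆ Metric.closedBall 0 s := by
    intro w hw
    rw [mem_closedBall_zero_iff]
    have h1 : dist w z < (1 - ρ) / 2 := hw
    rw [dist_eq_norm] at h1
    have h2 : ‖w‖ ≤ ‖w - z‖ + ‖z‖ := by simpa using norm_add_le (w - z) z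
    rw [hs]
    linarith
  have h1 := area_lower_bound (g := fun w => g w ^ 2) hR
    ((hg.pow 2).mono (hball.trans hK))
  have h2 : ENNReal.ofReal A * ‖g z‖ₑ ^ 2 ≤ ∫⁻ w, ‖g w‖ₑ ^ 2 ∂areaMeasure β := by
    calc ENNReal.ofReal A * ‖g z‖ₑ ^ 2
        ≤ ENNReal.ofReal m * ∫⁻ w in Metric.ball z ((1 - ρ) / 2), ‖g w‖ₑ ^ 2 := by
          rw [hA, ENNReal.ofReal_mul hm0.le, mul_assoc]
          simpa only [enorm_pow] using mul_le_mul_right h1 (ENNReal.ofReal m)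
      _ = ∫⁻ w in Metric.ball z ((1 - ρ) / 2), ENNReal.ofReal m * ‖g w‖ₑ ^ 2 := by
          rw [lintegral_const_mul' _ _ ENNReal.ofReal_ne_top]
      _ ≤ ∫⁻ w in Metric.ball z ((1 - ρ) / 2), ENNReal.ofReal (weight β w) * ‖g w‖ₑ ^ 2 := by
          refine setLIntegral_mono' measurableSet_ball fun w hw => ?_
          exact mul_le_mul_left (ENNReal.ofReal_le_ofReal (hmin (hball hw))) _
      _ ≤ ∫⁻ w in disk, ENNReal.ofReal (weight β w) * ‖g w‖ₑ ^ 2 :=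
          lintegral_mono_set (hball.trans hK)
      _ = ∫⁻ w, ‖g w‖ₑ ^ 2 ∂areaMeasure β := by
          rw [areaMeasure, lintegral_withDensity_eq_lintegral_mul_non_measurable₀]
          · rfl
          · exact (((continuousOn_weight β).aestronglyMeasurable
              measurableSet_ball).aemeasurable).ennreal_ofReal
          · exact Eventually.of_forall fun _ => ENNReal.ofReal_lt_top
  have h3 : ‖g z‖ₑ ^ 2 ≤ ENNReal.ofReal A⁻¹ * ∫⁻ w, ‖g w‖ₑ ^ 2 ∂areaMeasure β := by
    rw [ENNReal.ofReal_inv_of_pos hA0]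
    refine le_trans (le_of_eq ?_) (mul_le_mul_right h2 _)
    rw [← mul_assoc, ENNReal.inv_mul_cancel (by simpa using hA0) ENNReal.ofReal_ne_top, one_mul]
  rw [eLpNorm_eq_lintegral_rpow_enorm_toReal (by simp) (by simp)]
  simp only [ENNReal.toReal_ofNat, ENNReal.rpow_ofNat]
  rw [ENNReal.coe_rpow_of_nonneg _ (by norm_num), ← ENNReal.mul_rpow_of_nonneg _ _ (by norm_num)]
  calc ‖g z‖ₑ = (‖g z‖ₑ ^ 2) ^ (1 / 2 : ℝ) := by
        rw [← ENNReal.rpow_ofNat, ← ENNReal.rpow_mul]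
        norm_num
    _ ≤ _ := ENNReal.rpow_le_rpow h3 (by norm_num)

theorem isClosed_bergman (α : ℝ) : IsClosed (bergman α : Set (Lp ℂ 2 (areaMeasure α))) := by
  refine isClosed_of_closure_subset fun f hf => ?_
  obtain ⟨u, hu, hlim⟩ := mem_closure_iff_seq_limit.1 hf
  choose g hg hug using hu
  have hdiff : ∀ {ρ : ℝ}, ρ < 1 → ∃ C : ℝ≥0, ∀ n m : ℕ, ∀ z : ℂ, ‖z‖ ≤ ρ →
      ‖g n z - g m z‖ ≤ C * ‖u n - u m‖ := by
    intro ρ hρ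
    obtain ⟨C, hC⟩ := eval_bound α hρ
    refine ⟨C, fun n m z hz => ?_⟩
    have h1 := hC (fun w => g n w - g m w) ((hg n).sub (hg m)) z hz
    have h2 : eLpNorm (fun w => g n w - g m w) 2 (areaMeasure α) = ‖u n - u m‖ₑ := by
      rw [Lp.enorm_def]
      refine eLpNorm_congr_ae ?_
      filter_upwards [Lp.coeFn_sub (u n) (u m), hug n, hug m] with w h3 h4 h5
      rw [h3, Pi.sub_apply, h4, h5]
    rw [h2, ← ofReal_norm, ← ofReal_norm, ← ENNReal.ofReal_coe_nnreal,
      ← ENNReal.ofReal_mul C.coe_nonneg] at h1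
    exact (ENNReal.ofReal_le_ofReal_iff (by positivity)).1 h1
  have hcau : CauchySeq u := hlim.cauchySeq
  have hucs : ∀ {ρ : ℝ}, ρ < 1 → UniformCauchySeqOn g atTop (Metric.closedBall (0 : ℂ) ρ) := by
    intro ρ hρ
    obtain ⟨C, hC⟩ := hdiff hρ
    rw [Metric.uniformCauchySeqOn_iff]
    intro ε hε
    obtain ⟨N, hN⟩ := Metric.cauchySeq_iff.1 hcau (ε / (C + 1)) (by positivity)
    refine ⟨N, fun n hn m hm z hz => ?_⟩
    rw [dist_eq_norm]
    have h1 := hN n hn m hm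
    rw [dist_eq_norm, lt_div_iff₀ (by positivity)] at h1
    have h2 := hC n m z (by simpa using hz)
    nlinarith [norm_nonneg (u n - u m)]
  have hex : ∀ z : ℂ, ∃ l : ℂ, z ∈ disk → Tendsto (fun n => g n z) atTop (𝓝 l) := by
    intro z
    by_cases hz : z ∈ disk
    · have hz1 : ‖z‖ < 1 := by simpa using hz
      obtain ⟨l, hl⟩ := cauchySeq_tendsto_of_complete
        ((hucs hz1).cauchySeq (x := z) (by simp))
      exact ⟨l, fun _ => hl⟩
    · exact ⟨0, fun h => absurd h hz⟩
  choose G hG using hex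
  have hloc : TendstoLocallyUniformlyOn g G atTop disk := by
    rw [tendstoLocallyUniformlyOn_iff_forall_isCompact Metric.isOpen_ball]
    intro K hK hKc
    rcases K.eq_empty_or_nonempty with rfl | hne
    · exact tendstoUniformlyOn_empty
    obtain ⟨w, hw, hmax⟩ := hKc.exists_isMaxOn hne continuous_norm.continuousOn
    have hw1 : ‖w‖ < 1 := by simpa using hK hw
    have hsub : K ⊆ Metric.closedBall (0 : ℂ) ‖w‖ := fun z hz => by
      simpa using hmax hz
    exact ((hucs hw1).mono hsub).tendstoUniformlyOn_of_tendsto fun z hz => hG z (hK hz)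
  refine ⟨G, hloc.differentiableOn (Eventually.of_forall hg) Metric.isOpen_ball, ?_⟩
  obtain ⟨ns, hns, hae⟩ := (tendstoInMeasure_of_tendsto_Lp hlim).exists_seq_tendsto_ae
  filter_upwards [hae, ae_mem_disk α, ae_all_iff.2 hug] with z h1 h2 h3
  refine tendsto_nhds_unique h1 ?_
  simp only [h3]
  exact (hG z h2).comp hns.tendsto_atTop

instance instCompleteSpaceBergman (α : ℝ) : CompleteSpace (bergman α) :=
  (isClosed_bergman α).completeSpace_coe

/-! ### Multiplication operators, defect operators and sub-Bergman spaces -/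

/-- `φ` belongs to the closed unit ball of `H^∞`: it is analytic on the disk and bounded by `1`
there. -/
structure MemHInftyBall (φ : ℂ → ℂ) : Prop where
  differentiableOn : DifferentiableOn ℂ φ disk
  norm_le_one : ∀ z ∈ disk, ‖φ z‖ ≤ 1

theorem MemHInftyBall.ae_norm_mul_le {φ : ℂ → ℂ} (hφ : MemHInftyBall φ) (α : ℝ) (f : ℂ → ℂ) :
    ∀ᵐ z ∂areaMeasure α, ‖φ z * f z‖ ≤ ‖f z‖ := by
  filter_upwards [ae_mem_disk α] with z hz
  rw [norm_mul]
  exact mul_le_of_le_one_left (norm_nonneg _) (hφ.norm_le_one z hz)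

theorem MemHInftyBall.memLp_mul {φ : ℂ → ℂ} (hφ : MemHInftyBall φ) {α : ℝ}
    (f : Lp ℂ 2 (areaMeasure α)) : MemLp (fun z => φ z * f z) 2 (areaMeasure α) :=
  (Lp.memLp f).of_le
    ((aestronglyMeasurable_of_differentiableOn α hφ.differentiableOn).mul
      (Lp.memLp f).aestronglyMeasurable)
    (hφ.ae_norm_mul_le α f)

/-- The function `φ f`, as an element of `A²_α`, for `f` in `A²_α`. -/
noncomputable def mulFun (α : ℝ) {φ : ℂ → ℂ} (hφ : MemHInftyBall φ) (f : bergman α) :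
    bergman α :=
  ⟨(hφ.memLp_mul (f : Lp ℂ 2 (areaMeasure α))).toLp _, by
    obtain ⟨g, hg, hfg⟩ := f.2
    refine ⟨fun z => φ z * g z, hφ.differentiableOn.mul hg, ?_⟩
    filter_upwards [(hφ.memLp_mul (f : Lp ℂ 2 (areaMeasure α))).coeFn_toLp, hfg] with z h1 h2
    rw [h1, h2]⟩

theorem coeFn_mulFun (α : ℝ) {φ : ℂ → ℂ} (hφ : MemHInftyBall φ) (f : bergman α) :
    ((mulFun α hφ f : Lp ℂ 2 (areaMeasure α)) : ℂ → ℂ) =ᵐ[areaMeasure α]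
      fun z => φ z * (f : Lp ℂ 2 (areaMeasure α)) z :=
  (hφ.memLp_mul (f : Lp ℂ 2 (areaMeasure α))).coeFn_toLp

theorem mulFun_add (α : ℝ) {φ : ℂ → ℂ} (hφ : MemHInftyBall φ) (f g : bergman α) :
    mulFun α hφ (f + g) = mulFun α hφ f + mulFun α hφ g := by
  refine Subtype.ext (Lp.ext ?_)
  refine (coeFn_mulFun α hφ (f + g)).trans ?_
  rw [Submodule.coe_add, Submodule.coe_add]
  filter_upwards [coeFn_mulFun α hφ f, coeFn_mulFun α hφ g,
    Lp.coeFn_add (f : Lp ℂ 2 (areaMeasure α)) (g : Lp ℂ 2 (areaMeasure α)),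
    Lp.coeFn_add (mulFun α hφ f : Lp ℂ 2 (areaMeasure α))
      (mulFun α hφ g : Lp ℂ 2 (areaMeasure α))] with z h1 h2 h3 h4
  rw [h3, h4, Pi.add_apply, Pi.add_apply, h1, h2, mul_add]

theorem mulFun_smul (α : ℝ) {φ : ℂ → ℂ} (hφ : MemHInftyBall φ) (c : ℂ) (f : bergman α) :
    mulFun α hφ (c • f) = c • mulFun α hφ f := by
  refine Subtype.ext (Lp.ext ?_)
  refine (coeFn_mulFun α hφ (c • f)).trans ?_
  rw [Submodule.coe_smul, Submodule.coe_smul]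
  filter_upwards [coeFn_mulFun α hφ f, Lp.coeFn_smul c (f : Lp ℂ 2 (areaMeasure α)),
    Lp.coeFn_smul c (mulFun α hφ f : Lp ℂ 2 (areaMeasure α))] with z h1 h2 h3
  rw [h2, h3, Pi.smul_apply, Pi.smul_apply, h1, smul_eq_mul, smul_eq_mul, mul_left_comm]

theorem norm_mulFun_le (α : ℝ) {φ : ℂ → ℂ} (hφ : MemHInftyBall φ) (f : bergman α) :
    ‖mulFun α hφ f‖ ≤ 1 * ‖f‖ := by
  rw [one_mul]
  refine Lp.norm_le_norm_of_ae_le (f := (mulFun α hφ f : Lp ℂ 2 (areaMeasure α)))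
    (g := (f : Lp ℂ 2 (areaMeasure α))) ?_
  filter_upwards [coeFn_mulFun α hφ f, hφ.ae_norm_mul_le α (f : Lp ℂ 2 (areaMeasure α))]
    with z h1 h2
  rwa [h1]

/-- The (contractive) multiplication operator `T_φ f = φ f` on `A²_α`. -/
noncomputable def mulOp (α : ℝ) {φ : ℂ → ℂ} (hφ : MemHInftyBall φ) :
    bergman α →L[ℂ] bergman α :=
  LinearMap.mkContinuous
    { toFun := mulFun α hφ
      map_add' := mulFun_add α hφ
      map_smul' := mulFun_smul α hφ }
    1 (norm_mulFun_le α hφ)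

/-- The defect operator `(I - T T^*)^{1/2}` (positive square root) of a contraction `T` on a
Hilbert space. -/
noncomputable def defect {H : Type*} [NormedAddCommGroup H] [InnerProductSpace ℂ H]
    [CompleteSpace H] (T : H →L[ℂ] H) : H →L[ℂ] H :=
  CFC.sqrt (1 - T * ContinuousLinearMap.adjoint T)

/-- The defect operator `D_φ = (I - T_φ T_φ^*)^{1/2}` on `A²_α`. -/
noncomputable def defectOp (α : ℝ) {φ : ℂ → ℂ} (hφ : MemHInftyBall φ) :
    bergman α →L[ℂ] bergman α :=
  defect (mulOp α hφ)

/-- The sub-Bergman space `H^α(φ)`: the analytic functions on the disk (values of `f` off the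
disk play no role) that lie in the range of the defect operator. -/
def subBergman (α : ℝ) {φ : ℂ → ℂ} (hφ : MemHInftyBall φ) : Set (ℂ → ℂ) :=
  {f | DifferentiableOn ℂ f disk ∧
    ∃ h : bergman α, (defectOp α hφ h : Lp ℂ 2 (areaMeasure α)) =ᵐ[areaMeasure α] f}

/-! ### Generalized Bergman spaces and finite Blaschke products -/

/-- The least non-negative integer `k` with `2k + β > -1`. -/
noncomputable def bergmanOrder (β : ℝ) : ℕ := sInf {k : ℕ | -1 < 2 * (k : ℝ) + β}

/-- The generalized Bergman space `A²_β`, for any real `β`: the analytic functions `f` on the disk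
(values of `f` off the disk play no role) with `∫ (1 - |z|²)^{2k} |f^{(k)}(z)|² dA_β(z) < ∞`,
where `2k + β > -1`. -/
def genBergman (β : ℝ) : Set (ℂ → ℂ) :=
  {f | DifferentiableOn ℂ f disk ∧
    ∫⁻ z, ENNReal.ofReal ((1 - ‖z‖ ^ 2) ^ (2 * bergmanOrder β) *
      ‖iteratedDeriv (bergmanOrder β) f z‖ ^ 2) ∂areaMeasure β < ∞}

/-- `φ` agrees on the disk with a finite Blaschke product: a unimodular constant times a finite
(possibly empty) product of Möbius factors with zeros in the disk. -/
def IsFiniteBlaschkeProduct (φ : ℂ → ℂ) : Prop :=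
  ∃ (n : ℕ) (a : Fin n → ℂ) (c : ℂ), (∀ i, a i ∈ disk) ∧ ‖c‖ = 1 ∧
    ∀ z ∈ disk, φ z = c * ∏ i, (a i - z) / (1 - conj (a i) * z)

end SubBergman

/-! Everything rests on the identity `‖D x‖² = ‖x‖² - ‖T* x‖²` for the defect operator `D` of a
contraction `T` (`norm_defect_sq`), together with Douglas' principle: for self-adjoint operators, a
bound `‖A x‖ ≤ C ‖B x‖` forces the range of `A` into the range of `B`.

The reference operator is `Λ`, the defect operator of the shift `φ(z) = z`. In the normalized
monomials, `‖Λ f‖²` is a diagonal quadratic form with eigenvalues `λ_n = (α+1)/(n+α+1)`. As these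
are positive and decrease to `0`, `Λ` is injective and compact, and its range is given by `∑
|f_n|²/λ_n < ∞`. By Parseval's formula this range is `A²_{α-1}`, that is, `H^α(z) = A²_{α-1}`
(`subBergman_id`).

(b) implies (c). For a Möbius factor with zero `a`, a Hilbert space version of `|1 - āz|² - |a - z|²
= (1-|a|²)(1-|z|²)` expresses `‖D x‖` as a multiple of `‖Λ R* x‖`, where `R` is multiplication by
`(1-|a|)/(1-āz)`. Multiplication by a function of the unit ball of `H^∞` with bounded derivative
preserves `A²_{α-1}`, the range of `Λ`; the closed graph theorem turns this into `‖Λ T_g* x‖ ≤ C ‖Λ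
x‖`. Hence `‖D x‖` and `‖Λ x‖` are comparable (`norm_defectOp_mobius_bounds`). Products are handled
by `‖D_{ψχ} x‖² = ‖D_ψ x‖² + ‖D_χ T_ψ* x‖²`.

(d) implies (a). If the range of `D_φ` lies in that of the injective `Λ`, then `D_φ = Λ X` with `X`
bounded, and `Λ` is compact.

(a) implies (b). The reproducing kernels are eigenvectors of `T_φ*`, so the normalized kernel `k_w`
satisfies `‖D_φ k_w‖² = 1 - |φ(w)|²`. Since `k_w` tends weakly to `0` as `|w| → 1`, compactness
gives `|φ(w)| → 1`. Such a `φ` has finitely many zeros. Once they are divided out by Möbius factors,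
the maximum principle applied to the quotient and to its reciprocal shows that the quotient is a
unimodular constant. -/

namespace SubBergman

/-! ### Defect operators and comparison of ranges in a Hilbert space -/

section Hilbert

variable {H : Type*} [NormedAddCommGroup H] [InnerProductSpace ℂ H] [CompleteSpace H]

theorem one_sub_mul_adjoint_nonneg {T : H →L[ℂ] H} (hT : ‖T‖ ≤ 1) :
    0 ≤ 1 - T * ContinuousLinearMap.adjoint T := by
  rw [ContinuousLinearMap.nonneg_iff_isPositive]
  refine ⟨?_, fun x => ?_⟩
  · rw [← ContinuousLinearMap.isSelfAdjoint_iff_isSymmetric]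
    exact (IsSelfAdjoint.one _).sub (IsSelfAdjoint.mul_star_self T)
  · rw [ContinuousLinearMap.reApplyInnerSelf_apply]
    have h1 : inner ℂ ((1 - T * ContinuousLinearMap.adjoint T) x) x =
        inner ℂ x x - inner ℂ (ContinuousLinearMap.adjoint T x) (ContinuousLinearMap.adjoint T x) := by
      rw [ContinuousLinearMap.adjoint_inner_right]
      simp
    have h2 : ‖ContinuousLinearMap.adjoint T x‖ ≤ ‖x‖ := by
      refine (ContinuousLinearMap.le_opNorm _ x).trans ?_
      rw [LinearIsometryEquiv.norm_map]
      exact mul_le_of_le_one_left (norm_nonneg _) hT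
    rw [h1, map_sub, inner_self_eq_norm_sq, inner_self_eq_norm_sq]
    nlinarith [norm_nonneg (ContinuousLinearMap.adjoint T x)]

theorem defect_isSelfAdjoint (T : H →L[ℂ] H) : IsSelfAdjoint (defect T) :=
  (CFC.sqrt_nonneg _).isSelfAdjoint

theorem adjoint_defect (T : H →L[ℂ] H) : ContinuousLinearMap.adjoint (defect T) = defect T :=
  defect_isSelfAdjoint T

/-- Besides self-adjointness, this is all that is used about the square root afterwards: it replaces
operator identities by identities between norms. -/
theorem norm_defect_sq {T : H →L[ℂ] H} (hT : ‖T‖ ≤ 1) (x : H) :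
    ‖defect T x‖ ^ 2 = ‖x‖ ^ 2 - ‖ContinuousLinearMap.adjoint T x‖ ^ 2 := by
  have h1 : defect T * defect T = 1 - T * ContinuousLinearMap.adjoint T :=
    CFC.sqrt_mul_sqrt_self _ (one_sub_mul_adjoint_nonneg hT)
  have h2 : inner ℂ (defect T x) (defect T x) =
      inner ℂ x x - inner ℂ (ContinuousLinearMap.adjoint T x) (ContinuousLinearMap.adjoint T x) := by
    rw [ContinuousLinearMap.adjoint_inner_right, ← ContinuousLinearMap.adjoint_inner_left,
      adjoint_defect, ← mul_apply_eq_comp, h1]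
    simp [inner_sub_left]
  rw [inner_self_eq_norm_sq_to_K, inner_self_eq_norm_sq_to_K, inner_self_eq_norm_sq_to_K] at h2
  exact_mod_cast h2

/-- A vector lies in the range of `A†` if the functional it defines is dominated by `A`. -/
theorem exists_adjoint_eq_of_bound (A : H →L[ℂ] H) (y : H) (C : ℝ)
    (h : ∀ x, ‖inner ℂ y x‖ ≤ C * ‖A x‖) : ∃ v, ContinuousLinearMap.adjoint A v = y := by
  -- The bound makes `⟨y, ·⟩` vanish on the kernel of `A`, so it descends to a functional on the
  -- range, bounded by `C`. Hahn–Banach extends it to `H`, and Riesz represents the extension by the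
  -- required `v`.
  have hker : LinearMap.ker A.toLinearMap ≤ LinearMap.ker (innerSL ℂ y).toLinearMap := by
    intro x hx
    have hx0 : A x = 0 := hx
    have := h x
    rw [hx0, norm_zero, mul_zero] at this
    simpa using this
  obtain ⟨g, hg⟩ : ∃ g : LinearMap.range A.toLinearMap →ₗ[ℂ] ℂ, ∀ x,
      g ⟨A x, LinearMap.mem_range_self A.toLinearMap x⟩ = inner ℂ y x := by
    refine ⟨((LinearMap.ker A.toLinearMap).liftQ (innerSL ℂ y).toLinearMap hker).comp
      (A.toLinearMap.quotKerEquivRange.symm.toLinearMap), fun x => ?_⟩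
    have h1 : A.toLinearMap.quotKerEquivRange.symm
        ⟨A x, LinearMap.mem_range_self A.toLinearMap x⟩ =
        (LinearMap.ker A.toLinearMap).mkQ x :=
      LinearMap.quotKerEquivRange_symm_apply_image A.toLinearMap x _
    rw [LinearMap.comp_apply, LinearEquiv.coe_coe, h1]
    simp
  have hgb : ∀ z, ‖g z‖ ≤ C * ‖z‖ := by
    rintro ⟨_, x, rfl⟩
    exact (congrArg norm (hg x)).le.trans (h x)
  obtain ⟨G, hG, -⟩ := exists_extension_norm_eq (𝕜 := ℂ) (LinearMap.range A.toLinearMap)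
    (g.mkContinuous C hgb)
  refine ⟨(InnerProductSpace.toDual ℂ H).symm G, ext_inner_right ℂ fun x => ?_⟩
  rw [ContinuousLinearMap.adjoint_inner_left, InnerProductSpace.toDual_symm_apply, ← hg x]
  exact hG ⟨A x, LinearMap.mem_range_self A.toLinearMap x⟩

/-- One half of Douglas' lemma: `|⟨A u, x⟩| = |⟨u, A x⟩| ≤ ‖u‖ C ‖B x‖`. -/
theorem range_le_range_of_norm_le {A B : H →L[ℂ] H} (hA : IsSelfAdjoint A)
    (hB : IsSelfAdjoint B) {C : ℝ} (h : ∀ x, ‖A x‖ ≤ C * ‖B x‖) (u : H) : ∃ v, B v = A u := by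
  obtain ⟨v, hv⟩ := exists_adjoint_eq_of_bound B (A u) (‖u‖ * C) fun x => by
    rw [← hA.adjoint_eq, ContinuousLinearMap.adjoint_inner_left, mul_assoc]
    exact (norm_inner_le_norm _ _).trans (mul_le_mul_of_nonneg_left (h x) (norm_nonneg _))
  exact ⟨v, by rwa [hB.adjoint_eq] at hv⟩

/-- Operators whose range is contained in the range of an injective operator factor through it. -/
theorem exists_factorization_of_range_le {A B : H →L[ℂ] H} (hB : Function.Injective B)
    (h : ∀ x, ∃ y, B y = A x) : ∃ X : H →L[ℂ] H, A = B * X := by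
  choose X hX using h
  let X' : H →ₗ[ℂ] H :=
    { toFun := X
      map_add' := fun x y => hB (by rw [map_add, hX, hX, hX, map_add])
      map_smul' := fun c x => hB (by rw [map_smul, hX, hX, map_smul]; rfl) }
  -- Closed graph theorem: if `u_n → x` and `X u_n → y`, then `B y = lim A u_n = A x = B (X x)`, and
  -- `B` is injective.
  refine ⟨⟨X', X'.continuous_of_seq_closed_graph fun u x y hu hXu => hB ?_⟩, ?_⟩
  · have h1 : Tendsto (fun n => B (X' (u n))) atTop (𝓝 (B y)) :=
      (B.continuous.tendsto y).comp hXu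
    have h2 : Tendsto (fun n => A (u n)) atTop (𝓝 (A x)) := (A.continuous.tendsto x).comp hu
    have h3 : ∀ n, B (X' (u n)) = A (u n) := fun n => hX _
    simp only [h3] at h1
    exact (tendsto_nhds_unique h1 h2).trans (hX x).symm
  · ext x
    exact (hX x).symm

/-- Invariance of the range of `B` under `T` gives `T B = B X` with `X` bounded; taking adjoints, `B
T* = X* B`. -/
theorem norm_comp_adjoint_le_of_range_invariant {B T : H →L[ℂ] H} (hB : IsSelfAdjoint B)
    (hinj : Function.Injective B) (h : ∀ x, ∃ y, B y = T (B x)) :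
    ∃ C : ℝ, 0 ≤ C ∧ ∀ x, ‖B (ContinuousLinearMap.adjoint T x)‖ ≤ C * ‖B x‖ := by
  obtain ⟨X, hX⟩ := exists_factorization_of_range_le (A := T * B) hinj h
  refine ⟨‖ContinuousLinearMap.adjoint X‖, norm_nonneg _, fun x => ?_⟩
  have h1 := congrArg star hX
  rw [star_mul, star_mul, hB.star_eq] at h1
  have h2 : B (ContinuousLinearMap.adjoint T x) = ContinuousLinearMap.adjoint X (B x) :=
    DFunLike.congr_fun h1 x
  rw [h2]
  exact ContinuousLinearMap.le_opNorm _ _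

end Hilbert

/-! ### Parseval's formula on circles and on the disk -/

theorem hasSum_norm_sq_of_hasSum_orthonormal {ι E : Type*} [NormedAddCommGroup E]
    [InnerProductSpace ℂ E] {v : ι → E} (hv : Orthonormal ℂ v) {c : ι → ℂ} {x : E}
    (h : HasSum (fun n => c n • v n) x) : HasSum (fun n => ‖c n‖ ^ 2) (‖x‖ ^ 2) := by
  have h1 : Tendsto (fun s : Finset ι => ‖∑ n ∈ s, c n • v n‖ ^ 2) atTop (𝓝 (‖x‖ ^ 2)) :=
    (Filter.Tendsto.norm h).pow 2
  refine h1.congr fun s => ?_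
  have h2 := hv.inner_sum c c s
  rw [inner_self_eq_norm_sq_to_K] at h2
  have h3 : ∀ n, conj (c n) * c n = ((‖c n‖ ^ 2 : ℝ) : ℂ) := fun n => by
    rw [Complex.conj_mul', Complex.ofReal_pow]
  simp only [h3] at h2
  apply Complex.ofReal_injective
  push_cast at h2 ⊢
  exact h2

/-- Absolute summability makes the series converge uniformly, hence in `L²` of the circle, where the
Fourier monomials are orthonormal. The factor `2π` compares Lebesgue measure with normalized Haar
measure. -/
theorem lintegral_circle_tsum_sq {c : ℕ → ℂ} (hc : Summable fun n => ‖c n‖) :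
    ∫⁻ θ in Ioo (-Real.pi) Real.pi, ‖∑' n, c n * Complex.exp (n * θ * Complex.I)‖ₑ ^ 2 =
      ENNReal.ofReal (2 * Real.pi) * ∑' n, ‖c n‖ₑ ^ 2 := by
  have : Fact (0 < 2 * Real.pi) := ⟨by positivity⟩
  have hsum : Summable fun n : ℕ => c n • (fourier n : C(AddCircle (2 * Real.pi), ℂ)) := by
    refine Summable.of_norm (hc.congr fun n => ?_)
    rw [norm_smul, fourier_norm, mul_one]
  set F := ∑' n : ℕ, c n • (fourier n : C(AddCircle (2 * Real.pi), ℂ)) with hF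
  have hval : ∀ θ : ℝ, F (θ : AddCircle (2 * Real.pi)) =
      ∑' n, c n * Complex.exp (n * θ * Complex.I) := by
    intro θ
    rw [hF, ← ContinuousMap.tsum_apply hsum (θ : AddCircle (2 * Real.pi))]
    refine tsum_congr fun n => ?_
    rw [ContinuousMap.smul_apply, fourier_coe_apply, smul_eq_mul]
    congr 2
    have : (Real.pi : ℂ) ≠ 0 := by exact_mod_cast Real.pi_ne_zero
    push_cast
    field_simp
  have hL : HasSum (fun n : ℕ => c n • (fourierLp (T := 2 * Real.pi) 2 (n : ℤ)))
      (ContinuousMap.toLp 2 AddCircle.haarAddCircle ℂ F) := by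
    have := hsum.hasSum.mapL (ContinuousMap.toLp (E := ℂ) 2
      (AddCircle.haarAddCircle (T := 2 * Real.pi)) ℂ)
    simpa using this
  have hnorm := hasSum_norm_sq_of_hasSum_orthonormal
    (orthonormal_fourier.comp _ Nat.cast_injective) hL
  have h1 : ∑' n, ‖c n‖ₑ ^ 2 =
      ‖ContinuousMap.toLp (E := ℂ) 2 (AddCircle.haarAddCircle (T := 2 * Real.pi)) ℂ F‖ₑ ^ 2 := by
    rw [← ofReal_norm, ← ENNReal.ofReal_pow (norm_nonneg _), ← hnorm.tsum_eq,
      ENNReal.ofReal_tsum_of_nonneg (fun n => by positivity) hnorm.summable]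
    refine tsum_congr fun n => ?_
    rw [← ofReal_norm, ← ENNReal.ofReal_pow (norm_nonneg _)]
  have h2 : ‖ContinuousMap.toLp (E := ℂ) 2 (AddCircle.haarAddCircle (T := 2 * Real.pi)) ℂ F‖ₑ ^ 2
      = ∫⁻ t, ‖F t‖ₑ ^ 2 ∂(AddCircle.haarAddCircle (T := 2 * Real.pi)) := by
    rw [Lp.enorm_def, eLpNorm_congr_ae (ContinuousMap.coeFn_toLp _ F),
      eLpNorm_eq_lintegral_rpow_enorm_toReal (by simp) (by simp)]
    simp only [ENNReal.toReal_ofNat, ENNReal.rpow_ofNat]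
    rw [← ENNReal.rpow_ofNat, ← ENNReal.rpow_mul]
    norm_num
  have h3 := AddCircle.lintegral_preimage (2 * Real.pi) (-Real.pi) fun t => ‖F t‖ₑ ^ 2
  rw [AddCircle.volume_eq_smul_haarAddCircle, lintegral_smul_measure] at h3
  rw [h1, h2, ← smul_eq_mul, ← h3, setLIntegral_congr Ioo_ae_eq_Ioc]
  simp only [hval]
  congr 3
  ring

/-- The `n`-th Taylor coefficient at the origin. -/
noncomputable def taylorCoeff (g : ℂ → ℂ) (n : ℕ) : ℂ := (n.factorial : ℂ)⁻¹ * iteratedDeriv n g 0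

theorem hasSum_taylorCoeff {g : ℂ → ℂ} (hg : DifferentiableOn ℂ g disk) {z : ℂ} (hz : z ∈ disk) :
    HasSum (fun n => taylorCoeff g n * z ^ n) (g z) := by
  have := Complex.hasSum_taylorSeries_on_ball hg hz
  simp only [sub_zero, smul_eq_mul] at this
  have h : (fun n => taylorCoeff g n * z ^ n) =
      fun n : ℕ => (n.factorial : ℂ)⁻¹ * (z ^ n * iteratedDeriv n g 0) := by
    ext n
    rw [taylorCoeff]
    ring
  rwa [h]

theorem taylorCoeff_deriv (g : ℂ → ℂ) (n : ℕ) :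
    taylorCoeff (deriv g) n = (n + 1) * taylorCoeff g (n + 1) := by
  rw [taylorCoeff, taylorCoeff, ← iteratedDeriv_succ', Nat.factorial_succ]
  have h1 : (n.factorial : ℂ) ≠ 0 := by exact_mod_cast n.factorial_ne_zero
  have h2 : (n + 1 : ℂ) ≠ 0 := by exact_mod_cast n.succ_ne_zero
  push_cast
  field_simp

/-- Polar coordinates, Parseval on each circle of radius `r < 1`, then Tonelli for the sum over `n`.
Both sides may be infinite, so no integrability of `g` is required. -/
theorem lintegral_disk_radial {g : ℂ → ℂ} (hg : DifferentiableOn ℂ g disk) {w : ℝ → ℝ≥0∞}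
    (hw : Measurable w) (hw' : ∀ r, w r ≠ ∞) :
    ∫⁻ z in disk, w ‖z‖ * ‖g z‖ₑ ^ 2 = ∑' n, ‖taylorCoeff g n‖ₑ ^ 2 *
      ∫⁻ r in Ioo (0 : ℝ) 1, ENNReal.ofReal (2 * Real.pi * r) * w r *
        ENNReal.ofReal (r ^ (2 * n)) := by
  set F : ℂ → ℝ≥0∞ := disk.indicator fun z => w ‖z‖ * ‖g z‖ₑ ^ 2 with hF
  have hFm : Measurable F := by
    have h1 : Measurable (disk.indicator fun z => ‖g z‖ₑ) := by
      classical
      have := hg.continuousOn.enorm.measurable_piecewise (g := (0 : ℂ → ℝ≥0∞))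
        continuousOn_const measurableSet_ball
      rwa [piecewise_eq_indicator] at this
    have h2 : F = fun z => w ‖z‖ * disk.indicator (fun z => ‖g z‖ₑ) z ^ 2 := by
      ext z
      rw [hF]
      by_cases hz : z ∈ disk <;> simp [hz]
    rw [h2]
    exact (hw.comp measurable_norm).mul (h1.pow_const 2)
  rw [← lintegral_indicator measurableSet_ball, ← Complex.lintegral_comp_polarCoord_symm]
  have hprod : (volume : Measure (ℝ × ℝ)).restrict polarCoord.target =
      (volume.restrict (Ioi (0 : ℝ))).prod (volume.restrict (Ioo (-Real.pi) Real.pi)) := by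
    have htarget : polarCoord.target = Ioi (0 : ℝ) ×ˢ Ioo (-Real.pi) Real.pi := rfl
    rw [htarget, Measure.prod_restrict, Measure.volume_eq_prod]
  have hsymm : Measurable fun p : ℝ × ℝ => Complex.polarCoord.symm p := by
    simp only [Complex.polarCoord_symm_apply]
    fun_prop
  rw [hprod, lintegral_prod _ (by
    simp only [smul_eq_mul]
    exact ((by fun_prop : Measurable fun p : ℝ × ℝ => ENNReal.ofReal p.1).mul
      (hFm.comp hsymm)).aemeasurable)]
  have hpol : ∀ r θ : ℝ, Complex.polarCoord.symm (r, θ) = r * Complex.exp (θ * Complex.I) := by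
    intro r θ
    rw [Complex.polarCoord_symm_apply, Complex.exp_mul_I, Complex.ofReal_cos, Complex.ofReal_sin]
  have hin : ∀ r ∈ Ioi (0 : ℝ), ∫⁻ θ in Ioo (-Real.pi) Real.pi,
      ENNReal.ofReal r • F (Complex.polarCoord.symm (r, θ)) =
      (Ioo (0 : ℝ) 1).indicator (fun r => ∑' n, ‖taylorCoeff g n‖ₑ ^ 2 *
        (ENNReal.ofReal (2 * Real.pi * r) * w r * ENNReal.ofReal (r ^ (2 * n)))) r := by
    intro r (hr : 0 < r)
    have hn : ∀ θ, ‖Complex.polarCoord.symm (r, θ)‖ = r := fun θ => by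
      rw [Complex.norm_polarCoord_symm, abs_of_pos hr]
    by_cases hr1 : r < 1
    · have hmem : ∀ θ, Complex.polarCoord.symm (r, θ) ∈ disk := fun θ => by
        rw [mem_ball_zero_iff, hn]
        exact hr1
      have hrm : (r : ℂ) ∈ disk := by
        rw [mem_ball_zero_iff, Complex.norm_real, Real.norm_of_nonneg hr.le]
        exact hr1
      have hc : Summable fun n => ‖taylorCoeff g n * (r : ℂ) ^ n‖ :=
        (hasSum_taylorCoeff hg hrm).summable.norm
      have hval : ∀ θ : ℝ, g (Complex.polarCoord.symm (r, θ)) =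
          ∑' n, taylorCoeff g n * (r : ℂ) ^ n * Complex.exp (n * θ * Complex.I) := by
        intro θ
        rw [← (hasSum_taylorCoeff hg (hmem θ)).tsum_eq]
        refine tsum_congr fun n => ?_
        rw [hpol, mul_pow, ← Complex.exp_nat_mul, mul_assoc, mul_assoc]
      rw [indicator_of_mem (show r ∈ Ioo (0 : ℝ) 1 from ⟨hr, hr1⟩)]
      simp only [hF, indicator_of_mem (hmem _), hn, smul_eq_mul, hval]
      simp only [← mul_assoc]
      rw [lintegral_const_mul', lintegral_circle_tsum_sq hc, ENNReal.tsum_mul_left.symm,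
        ENNReal.tsum_mul_left.symm]
      · refine tsum_congr fun n => ?_
        have h4 : ‖taylorCoeff g n * (r : ℂ) ^ n‖ₑ ^ 2 =
            ‖taylorCoeff g n‖ₑ ^ 2 * ENNReal.ofReal (r ^ (2 * n)) := by
          rw [enorm_mul, enorm_pow, mul_pow, ← ofReal_norm (r : ℂ), Complex.norm_real,
            Real.norm_of_nonneg hr.le, ENNReal.ofReal_pow hr.le, ← pow_mul, mul_comm n]
        rw [h4, ENNReal.ofReal_mul (p := 2 * Real.pi) (by positivity)]
        ring
      · exact ENNReal.mul_ne_top ENNReal.ofReal_ne_top (hw' r)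
    · rw [indicator_of_notMem (fun h => hr1 h.2)]
      have hmem : ∀ θ, Complex.polarCoord.symm (r, θ) ∉ disk := fun θ => by
        rw [mem_ball_zero_iff, hn]
        exact hr1
      simp only [hF, indicator_of_notMem (hmem _), smul_zero, lintegral_zero]
  rw [setLIntegral_congr_fun measurableSet_Ioi hin, setLIntegral_indicator measurableSet_Ioo,
    inter_eq_left.2 (fun x hx => hx.1), lintegral_tsum]
  · refine tsum_congr fun n => ?_
    rw [lintegral_const_mul' _ _ (by simp)]
  · intro n
    fun_prop

/-- The substitution `t = r²` produces the Beta integral, whose value is read off from the total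
mass `1` of the Beta distribution. -/
theorem lintegral_radial_beta (n : ℕ) {β : ℝ} (hβ : -1 < β) :
    ∫⁻ r in Ioo (0 : ℝ) 1, ENNReal.ofReal (2 * r * (r ^ (2 * n) * (1 - r ^ 2) ^ β)) =
      ENNReal.ofReal (ProbabilityTheory.beta (n + 1) (β + 1)) := by
  have hb : 0 < ProbabilityTheory.beta (n + 1) (β + 1) :=
    ProbabilityTheory.beta_pos (by positivity) (by linarith)
  have h1 := ProbabilityTheory.lintegral_betaPDF_eq_one (α := (n + 1 : ℝ)) (β := β + 1)
    (by positivity) (by linarith)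
  rw [ProbabilityTheory.lintegral_betaPDF] at h1
  have himg : (fun r : ℝ => r ^ 2) '' Ioo 0 1 = Ioo 0 1 := by
    ext t
    constructor
    · rintro ⟨r, hr, rfl⟩
      exact ⟨pow_pos hr.1 2, pow_lt_one₀ hr.1.le hr.2 two_ne_zero⟩
    · intro ht
      refine ⟨√t, ⟨Real.sqrt_pos.2 ht.1, ?_⟩, Real.sq_sqrt ht.1.le⟩
      rw [Real.sqrt_lt' one_pos]
      simpa using ht.2
  have h2 := lintegral_image_eq_lintegral_abs_deriv_mul (s := Ioo (0 : ℝ) 1)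
    (f := fun r => r ^ 2) (f' := fun r => 2 * r) measurableSet_Ioo
    (fun r _ => by simpa using (hasDerivAt_pow 2 r).hasDerivWithinAt)
    (fun x hx y hy hxy => by
      exact (pow_left_inj₀ hx.1.le hy.1.le two_ne_zero).1 hxy)
    (fun t => ENNReal.ofReal (1 / ProbabilityTheory.beta (n + 1) (β + 1) * t ^ (n + 1 - 1 : ℝ) *
      (1 - t) ^ (β + 1 - 1)))
  rw [himg, h1] at h2
  have h3 : ∀ r ∈ Ioo (0 : ℝ) 1, ENNReal.ofReal (2 * r * (r ^ (2 * n) * (1 - r ^ 2) ^ β)) =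
      ENNReal.ofReal (ProbabilityTheory.beta (n + 1) (β + 1)) * (ENNReal.ofReal |2 * r| *
      ENNReal.ofReal (1 / ProbabilityTheory.beta (n + 1) (β + 1) * (r ^ 2) ^ (n + 1 - 1 : ℝ) *
      (1 - r ^ 2) ^ (β + 1 - 1))) := by
    intro r hr
    have hr0 : 0 < r := hr.1
    rw [← ENNReal.ofReal_mul (abs_nonneg _), ← ENNReal.ofReal_mul hb.le,
      abs_of_pos (by positivity)]
    congr 1
    rw [add_sub_cancel_right, add_sub_cancel_right, Real.rpow_natCast, ← pow_mul]
    field_simp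
  rw [setLIntegral_congr_fun measurableSet_Ioo h3, lintegral_const_mul' _ _ ENNReal.ofReal_ne_top,
    ← h2, mul_one]

/-- Parseval's formula for the standard weights on the disk. -/
theorem lintegral_disk_weight {g : ℂ → ℂ} (hg : DifferentiableOn ℂ g disk) {β K : ℝ}
    (hβ : -1 < β) (hK : 0 ≤ K) :
    ∫⁻ z in disk, ENNReal.ofReal (K / Real.pi * (1 - ‖z‖ ^ 2) ^ β) * ‖g z‖ₑ ^ 2 =
      ∑' n, ‖taylorCoeff g n‖ₑ ^ 2 *
        ENNReal.ofReal (K * ProbabilityTheory.beta (n + 1) (β + 1)) := by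
  rw [lintegral_disk_radial (w := fun r => ENNReal.ofReal (K / Real.pi * (1 - r ^ 2) ^ β)) hg
    (by fun_prop) (fun r => ENNReal.ofReal_ne_top)]
  refine tsum_congr fun n => ?_
  congr 1
  rw [ENNReal.ofReal_mul hK, ← lintegral_radial_beta n hβ,
    ← lintegral_const_mul' _ _ ENNReal.ofReal_ne_top]
  refine setLIntegral_congr_fun measurableSet_Ioo fun r hr => ?_
  have hr0 : 0 < r := hr.1
  have hr1 : 0 < 1 - r ^ 2 := by nlinarith [hr.1, hr.2]
  have hr2 : 0 ≤ (1 - r ^ 2) ^ β := Real.rpow_nonneg hr1.le _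
  have := Real.pi_pos
  rw [← ENNReal.ofReal_mul (by positivity), ← ENNReal.ofReal_mul (by positivity),
    ← ENNReal.ofReal_mul hK]
  congr 1
  field_simp

/-! ### Moments of the standard weights -/

/-- The squared norm of `z ^ n` in `A²_α`. -/
noncomputable def moment (α : ℝ) (n : ℕ) : ℝ := (α + 1) * ProbabilityTheory.beta (n + 1) (α + 1)

/-- The eigenvalues of `I - T_z T_z^*` on `A²_α`. -/
noncomputable def shiftEigenvalue (α : ℝ) (n : ℕ) : ℝ := (α + 1) / (n + α + 1)

variable {α : ℝ}

theorem moment_pos (hα : -1 < α) (n : ℕ) : 0 < moment α n :=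
  mul_pos (by linarith) (ProbabilityTheory.beta_pos (by positivity) (by linarith))

theorem shiftEigenvalue_pos (hα : -1 < α) (n : ℕ) : 0 < shiftEigenvalue α n :=
  div_pos (by linarith) (by have : (0 : ℝ) ≤ n := n.cast_nonneg; linarith)

theorem shiftEigenvalue_zero (hα : -1 < α) : shiftEigenvalue α 0 = 1 := by
  have : α + 1 ≠ 0 := by linarith
  rw [shiftEigenvalue, Nat.cast_zero, zero_add, div_self this]

theorem beta_add_one_left {a b : ℝ} (ha : 0 < a) (hb : 0 < b) :
    ProbabilityTheory.beta (a + 1) b = ProbabilityTheory.beta a b * (a / (a + b)) := by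
  have h1 := (Real.Gamma_pos_of_pos (add_pos ha hb)).ne'
  have h2 : a + b ≠ 0 := by linarith
  rw [ProbabilityTheory.beta, ProbabilityTheory.beta, Real.Gamma_add_one ha.ne', add_right_comm,
    Real.Gamma_add_one h2]
  field_simp

theorem beta_add_one_right {a b : ℝ} (ha : 0 < a) (hb : 0 < b) :
    ProbabilityTheory.beta a (b + 1) = ProbabilityTheory.beta a b * (b / (a + b)) := by
  have h1 := (Real.Gamma_pos_of_pos (add_pos ha hb)).ne'
  have h2 : a + b ≠ 0 := by linarith
  rw [ProbabilityTheory.beta, ProbabilityTheory.beta, Real.Gamma_add_one hb.ne', ← add_assoc,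
    Real.Gamma_add_one h2]
  field_simp

/-- The ratio of consecutive squared norms is the squared weight of the shift, which is why `1`
minus it is an eigenvalue of `I - T_z T_z*`. -/
theorem moment_succ (hα : -1 < α) (n : ℕ) :
    moment α (n + 1) = moment α n * (1 - shiftEigenvalue α (n + 1)) := by
  have h0 : (0 : ℝ) ≤ n := n.cast_nonneg
  have h1 : (n : ℝ) + 1 + α + 1 ≠ 0 := by linarith
  have h2 : (n : ℝ) + 1 + (α + 1) ≠ 0 := by linarith
  rw [moment, moment, Nat.cast_succ, beta_add_one_left (by linarith) (by linarith),
    shiftEigenvalue, Nat.cast_succ]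
  field_simp
  ring

theorem moment_le_one (hα : -1 < α) (n : ℕ) : moment α n ≤ 1 := by
  induction n with
  | zero =>
    have h1 : α + 1 ≠ 0 := by linarith
    have h2 := (Real.Gamma_pos_of_pos (show 0 < α + 1 by linarith)).ne'
    rw [moment, ProbabilityTheory.beta, Nat.cast_zero, zero_add, Real.Gamma_one, add_comm 1,
      Real.Gamma_add_one h1]
    field_simp
    rfl
  | succ n ih =>
    rw [moment_succ hα]
    have h1 := shiftEigenvalue_pos hα (n + 1)
    nlinarith [moment_pos hα n]

/-! ### Taylor coefficients of analytic functions -/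

theorem lintegral_areaMeasure (β : ℝ) (F : ℂ → ℝ≥0∞) :
    ∫⁻ z, F z ∂areaMeasure β = ∫⁻ z in disk, ENNReal.ofReal (weight β z) * F z := by
  rw [areaMeasure, lintegral_withDensity_eq_lintegral_mul_non_measurable₀]
  · rfl
  · exact (((continuousOn_weight β).aestronglyMeasurable
      measurableSet_ball).aemeasurable).ennreal_ofReal
  · exact Eventually.of_forall fun _ => ENNReal.ofReal_lt_top

theorem lintegral_enorm_sq_areaMeasure (hα : -1 < α) {g : ℂ → ℂ}
    (hg : DifferentiableOn ℂ g disk) :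
    ∫⁻ z, ‖g z‖ₑ ^ 2 ∂areaMeasure α =
      ∑' n, ‖taylorCoeff g n‖ₑ ^ 2 * ENNReal.ofReal (moment α n) := by
  rw [lintegral_areaMeasure]
  have := lintegral_disk_weight hg hα (show 0 ≤ α + 1 by linarith)
  simpa only [weight, normConst, if_pos hα, moment] using this

theorem taylorCoeff_congr {f g : ℂ → ℂ} (h : ∀ z ∈ disk, f z = g z) (n : ℕ) :
    taylorCoeff f n = taylorCoeff g n := by
  have : f =ᶠ[𝓝 0] g := by
    filter_upwards [Metric.ball_mem_nhds (0 : ℂ) one_pos] with z hz using h z hz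
  rw [taylorCoeff, taylorCoeff, this.iteratedDeriv_eq]

theorem contDiffAt_of_differentiableOn_disk {f : ℂ → ℂ} (hf : DifferentiableOn ℂ f disk) (n : ℕ) :
    ContDiffAt ℂ n f 0 :=
  (hf.analyticAt (Metric.ball_mem_nhds (0 : ℂ) one_pos)).contDiffAt

theorem taylorCoeff_add {f g : ℂ → ℂ} (hf : DifferentiableOn ℂ f disk)
    (hg : DifferentiableOn ℂ g disk) (n : ℕ) :
    taylorCoeff (fun z => f z + g z) n = taylorCoeff f n + taylorCoeff g n := by
  have := iteratedDeriv_add (contDiffAt_of_differentiableOn_disk hf n)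
    (contDiffAt_of_differentiableOn_disk hg n)
  rw [taylorCoeff, taylorCoeff, taylorCoeff, ← mul_add, ← this]
  rfl

theorem taylorCoeff_const_mul (c : ℂ) (f : ℂ → ℂ) (n : ℕ) :
    taylorCoeff (fun z => c * f z) n = c * taylorCoeff f n := by
  rw [taylorCoeff, taylorCoeff, iteratedDeriv_const_mul_field, mul_left_comm]

theorem taylorCoeff_pow (m n : ℕ) :
    taylorCoeff (fun z => z ^ m) n = if n = m then 1 else 0 := by
  have h : (m.factorial : ℂ) ≠ 0 := by exact_mod_cast m.factorial_ne_zero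
  rw [taylorCoeff, iteratedDeriv_fun_pow_zero]
  split_ifs <;> simp_all

/-! ### Analytic representatives -/

/-- Point evaluations are dominated by the `L²` norm, so a difference of norm zero vanishes
everywhere on the disk. This allows pointwise work with representatives. -/
theorem eqOn_disk_of_ae_eq {β : ℝ} {f g : ℂ → ℂ} (hf : DifferentiableOn ℂ f disk)
    (hg : DifferentiableOn ℂ g disk) (h : f =ᵐ[areaMeasure β] g) : ∀ z ∈ disk, f z = g z := by
  intro z hz
  obtain ⟨C, hC⟩ := eval_bound β (show ‖z‖ < 1 by simpa using hz)
  have h1 := hC (fun w => f w - g w) (hf.sub hg) z le_rfl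
  have h2 : (fun w => f w - g w) =ᵐ[areaMeasure β] fun _ => (0 : ℂ) := by
    filter_upwards [h] with w hw
    rw [hw, sub_self]
  rw [eLpNorm_congr_ae h2] at h1
  simpa [sub_eq_zero] using h1

/-- The analytic representative of an element of `A²_α`. -/
noncomputable def rep (f : bergman α) : ℂ → ℂ := f.2.choose

theorem differentiableOn_rep (f : bergman α) : DifferentiableOn ℂ (rep f) disk :=
  f.2.choose_spec.1

theorem coeFn_ae_eq_rep (f : bergman α) :
    (f : Lp ℂ 2 (areaMeasure α)) =ᵐ[areaMeasure α] rep f :=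
  f.2.choose_spec.2

theorem rep_eq_of_ae_eq {f : bergman α} {g : ℂ → ℂ} (hg : DifferentiableOn ℂ g disk)
    (h : (f : Lp ℂ 2 (areaMeasure α)) =ᵐ[areaMeasure α] g) : ∀ z ∈ disk, rep f z = g z :=
  eqOn_disk_of_ae_eq (differentiableOn_rep f) hg ((coeFn_ae_eq_rep f).symm.trans h)

theorem ae_eq_of_rep_eq {f : bergman α} {g : ℂ → ℂ} (h : ∀ z ∈ disk, rep f z = g z) :
    (f : Lp ℂ 2 (areaMeasure α)) =ᵐ[areaMeasure α] g := by
  filter_upwards [coeFn_ae_eq_rep f, ae_mem_disk α] with z h1 h2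
  rw [h1, h z h2]

theorem bergman_ext {f g : bergman α} (h : ∀ z ∈ disk, rep f z = rep g z) : f = g :=
  Subtype.ext (Lp.ext ((ae_eq_of_rep_eq h).trans (coeFn_ae_eq_rep g).symm))

theorem rep_add (f g : bergman α) : ∀ z ∈ disk, rep (f + g) z = rep f z + rep g z := by
  refine rep_eq_of_ae_eq ((differentiableOn_rep f).add (differentiableOn_rep g)) ?_
  filter_upwards [Lp.coeFn_add (f : Lp ℂ 2 (areaMeasure α)) (g : Lp ℂ 2 (areaMeasure α)),
    coeFn_ae_eq_rep f, coeFn_ae_eq_rep g] with z h1 h2 h3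
  rw [Submodule.coe_add, h1, Pi.add_apply, h2, h3]

theorem rep_smul (c : ℂ) (f : bergman α) : ∀ z ∈ disk, rep (c • f) z = c * rep f z := by
  refine rep_eq_of_ae_eq ((differentiableOn_rep f).const_mul c) ?_
  filter_upwards [Lp.coeFn_smul c (f : Lp ℂ 2 (areaMeasure α)), coeFn_ae_eq_rep f] with z h1 h2
  rw [Submodule.coe_smul, h1, Pi.smul_apply, h2, smul_eq_mul]

theorem rep_sub (f g : bergman α) : ∀ z ∈ disk, rep (f - g) z = rep f z - rep g z := by
  intro z hz
  have := rep_add (f - g) g z hz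
  rw [sub_add_cancel] at this
  rw [this, add_sub_cancel_right]

theorem rep_mulOp {φ : ℂ → ℂ} (hφ : MemHInftyBall φ) (f : bergman α) :
    ∀ z ∈ disk, rep (mulOp α hφ f) z = φ z * rep f z := by
  refine rep_eq_of_ae_eq (hφ.differentiableOn.mul (differentiableOn_rep f)) ?_
  filter_upwards [coeFn_mulFun α hφ f, coeFn_ae_eq_rep f] with z h1 h2
  rw [← h2, ← h1]
  rfl

theorem norm_mulOp_le {φ : ℂ → ℂ} (hφ : MemHInftyBall φ) : ‖mulOp α hφ‖ ≤ 1 :=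
  LinearMap.mkContinuous_norm_le _ zero_le_one _

theorem eLpNorm_two_sq {μ : Measure ℂ} (g : ℂ → ℂ) :
    eLpNorm g 2 μ ^ 2 = ∫⁻ z, ‖g z‖ₑ ^ 2 ∂μ := by
  rw [eLpNorm_eq_lintegral_rpow_enorm_toReal (by simp) (by simp)]
  simp only [ENNReal.toReal_ofNat, ENNReal.rpow_ofNat]
  rw [← ENNReal.rpow_ofNat, ← ENNReal.rpow_mul]
  norm_num

theorem exists_rep_eq {g : ℂ → ℂ} (hg : DifferentiableOn ℂ g disk)
    (h : ∫⁻ z, ‖g z‖ₑ ^ 2 ∂areaMeasure α < ∞) :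
    ∃ f : bergman α, ∀ z ∈ disk, rep f z = g z := by
  have hm : MemLp g 2 (areaMeasure α) := by
    refine ⟨aestronglyMeasurable_of_differentiableOn α hg, ?_⟩
    rw [← eLpNorm_two_sq] at h
    exact lt_of_not_ge fun h1 => by simp [top_le_iff.1 h1] at h
  exact ⟨⟨hm.toLp g, g, hg, hm.coeFn_toLp⟩, rep_eq_of_ae_eq hg hm.coeFn_toLp⟩

theorem enorm_sq_eq_lintegral (f : bergman α) :
    ‖f‖ₑ ^ 2 = ∫⁻ z, ‖rep f z‖ₑ ^ 2 ∂areaMeasure α := by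
  rw [← eLpNorm_two_sq, ← eLpNorm_congr_ae (coeFn_ae_eq_rep f), ← Lp.enorm_def]
  rfl

/-! ### The orthonormal basis of normalized monomials -/

/-- The coefficient of `f` with respect to the `n`-th normalized monomial. -/
noncomputable def normCoeff (f : bergman α) (n : ℕ) : ℂ := √(moment α n) * taylorCoeff (rep f) n

theorem normCoeff_add (f g : bergman α) (n : ℕ) :
    normCoeff (f + g) n = normCoeff f n + normCoeff g n := by
  rw [normCoeff, normCoeff, normCoeff, taylorCoeff_congr (rep_add f g),
    taylorCoeff_add (differentiableOn_rep f) (differentiableOn_rep g), mul_add]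

theorem normCoeff_smul (c : ℂ) (f : bergman α) (n : ℕ) :
    normCoeff (c • f) n = c * normCoeff f n := by
  rw [normCoeff, normCoeff, taylorCoeff_congr (rep_smul c f), taylorCoeff_const_mul,
    mul_left_comm]

theorem enorm_normCoeff_sq (hα : -1 < α) (f : bergman α) (n : ℕ) :
    ‖normCoeff f n‖ₑ ^ 2 = ‖taylorCoeff (rep f) n‖ₑ ^ 2 * ENNReal.ofReal (moment α n) := by
  rw [normCoeff, enorm_mul, mul_pow, ← ofReal_norm, Complex.norm_real,
    Real.norm_of_nonneg (Real.sqrt_nonneg _), ← ENNReal.ofReal_pow (Real.sqrt_nonneg _),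
    Real.sq_sqrt (moment_pos hα n).le, mul_comm]

theorem hasSum_normCoeff_sq (hα : -1 < α) (f : bergman α) :
    HasSum (fun n => ‖normCoeff f n‖ ^ 2) (‖f‖ ^ 2) := by
  have h1 : ∑' n, ENNReal.ofReal (‖normCoeff f n‖ ^ 2) = ENNReal.ofReal (‖f‖ ^ 2) := by
    rw [ENNReal.ofReal_pow (norm_nonneg _), ofReal_norm, enorm_sq_eq_lintegral,
      lintegral_enorm_sq_areaMeasure hα (differentiableOn_rep f)]
    refine tsum_congr fun n => ?_
    rw [ENNReal.ofReal_pow (norm_nonneg _), ofReal_norm, enorm_normCoeff_sq hα]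
  have hs : Summable fun n => ‖normCoeff f n‖ ^ 2 := by
    have h2 := ENNReal.summable_toReal (h1.trans_ne ENNReal.ofReal_ne_top)
    refine h2.congr fun n => ?_
    rw [ENNReal.toReal_ofReal (by positivity)]
  rw [← ENNReal.ofReal_tsum_of_nonneg (fun n => by positivity) hs,
    ENNReal.ofReal_eq_ofReal_iff (tsum_nonneg fun n => by positivity) (by positivity)] at h1
  rw [← h1]
  exact hs.hasSum

/-- The isometry from `A²_α` into `ℓ²` given by the normalized coefficients. -/
noncomputable def coeffIsometry (hα : -1 < α) : bergman α →ₗᵢ[ℂ] lp (fun _ : ℕ => ℂ) 2 where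
  toFun f := ⟨normCoeff f, memℓp_gen (by simpa using (hasSum_normCoeff_sq hα f).summable)⟩
  map_add' f g := by
    ext n
    exact normCoeff_add f g n
  map_smul' c f := by
    ext n
    exact normCoeff_smul c f n
  norm_map' f := by
    have h1 := lp.hasSum_norm (p := 2) (by norm_num) (⟨normCoeff f,
      memℓp_gen (by simpa using (hasSum_normCoeff_sq hα f).summable)⟩ : lp (fun _ : ℕ => ℂ) 2)
    simp only [ENNReal.toReal_ofNat, Real.rpow_ofNat] at h1
    exact (pow_left_inj₀ (norm_nonneg _) (norm_nonneg _) two_ne_zero).1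
      (h1.unique (hasSum_normCoeff_sq hα f))

theorem exists_monomial (hα : -1 < α) (n : ℕ) :
    ∃ e : bergman α, ∀ z ∈ disk, rep e z = ((√(moment α n))⁻¹ : ℝ) * z ^ n := by
  refine exists_rep_eq (by fun_prop) ?_
  rw [lintegral_enorm_sq_areaMeasure hα (by fun_prop), tsum_eq_single n]
  · exact ENNReal.mul_lt_top (by simp) ENNReal.ofReal_lt_top
  · intro m hm
    rw [taylorCoeff_const_mul, taylorCoeff_pow, if_neg hm]
    simp

/-- The normalized monomials. -/
noncomputable def monomial (hα : -1 < α) (n : ℕ) : bergman α := (exists_monomial hα n).choose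

theorem rep_monomial (hα : -1 < α) (n : ℕ) :
    ∀ z ∈ disk, rep (monomial hα n) z = ((√(moment α n))⁻¹ : ℝ) * z ^ n :=
  (exists_monomial hα n).choose_spec

theorem normCoeff_monomial (hα : -1 < α) (m n : ℕ) :
    normCoeff (monomial hα m) n = if n = m then 1 else 0 := by
  rw [normCoeff, taylorCoeff_congr (rep_monomial hα m), taylorCoeff_const_mul, taylorCoeff_pow]
  split_ifs with h
  · subst h
    have h2 : (√(moment α n) : ℂ) ≠ 0 := by
      exact_mod_cast (Real.sqrt_pos.2 (moment_pos hα n)).ne'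
    rw [Complex.ofReal_inv, mul_one, mul_inv_cancel₀ h2]
  · simp

/-- The coefficient isometry sends the monomial to a unit vector of `ℓ²` and preserves inner
products, so no integral of a product has to be computed. -/
theorem inner_monomial (hα : -1 < α) (n : ℕ) (f : bergman α) :
    inner ℂ (monomial hα n) f = normCoeff f n := by
  have h1 : coeffIsometry hα (monomial hα n) = lp.single 2 n 1 := by
    ext m
    refine (normCoeff_monomial hα n m).trans ?_
    rw [lp.single_apply, Pi.single_apply]
  rw [← (coeffIsometry hα).inner_map_map, h1, lp.inner_single_left]
  exact (by simp : inner ℂ (1 : ℂ) (normCoeff f n) = normCoeff f n)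

theorem orthonormal_monomial (hα : -1 < α) : Orthonormal ℂ (monomial hα) := by
  rw [orthonormal_iff_ite]
  intro m n
  rw [inner_monomial, normCoeff_monomial]

theorem eq_zero_of_normCoeff_eq_zero (hα : -1 < α) {f : bergman α}
    (h : ∀ n, normCoeff f n = 0) : f = 0 := by
  have h1 := hasSum_normCoeff_sq hα f
  simp only [h, norm_zero, ne_eq, OfNat.ofNat_ne_zero, not_false_eq_true, zero_pow] at h1
  simpa using h1.unique hasSum_zero

/-- The normalized monomials as a Hilbert basis. -/
noncomputable def monomialBasis (hα : -1 < α) : HilbertBasis ℕ ℂ (bergman α) :=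
  HilbertBasis.mkOfOrthogonalEqBot (orthonormal_monomial hα) <| by
    rw [Submodule.eq_bot_iff]
    intro f hf
    refine eq_zero_of_normCoeff_eq_zero hα fun n => ?_
    rw [← inner_monomial hα]
    exact hf _ (Submodule.subset_span (mem_range_self n))

theorem coe_monomialBasis (hα : -1 < α) : ⇑(monomialBasis hα) = monomial hα :=
  HilbertBasis.coe_mkOfOrthogonalEqBot _ _

/-! ### Operators that are diagonal in the sense of quadratic forms -/

section Diagonal

variable {H : Type*} [NormedAddCommGroup H] [InnerProductSpace ℂ H]
  (b : HilbertBasis ℕ ℂ H) {D : H →L[ℂ] H} {l : ℕ → ℝ}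

theorem hasSum_hilbertBasis_inner_sq (x : H) :
    HasSum (fun n => ‖inner ℂ (b n) x‖ ^ 2) (‖x‖ ^ 2) := by
  refine hasSum_norm_sq_of_hasSum_orthonormal b.orthonormal ?_
  simpa only [b.repr_apply_apply] using b.hasSum_repr x

theorem inner_hilbertBasis_sum (c : ℕ → ℂ) (N n : ℕ) :
    inner ℂ (b n) (∑ k ∈ Finset.range N, c k • b k) = if n < N then c n else 0 := by
  simp only [inner_sum, inner_smul_right, orthonormal_iff_ite.1 b.orthonormal]
  simp

theorem injective_of_hasSum_diagonal
    (hl : ∀ n, 0 < l n)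
    (hD : ∀ x, HasSum (fun n => l n * ‖inner ℂ (b n) x‖ ^ 2) (‖D x‖ ^ 2)) : Function.Injective D := by
  rw [injective_iff_map_eq_zero]
  intro x hx
  have h1 := hD x
  rw [hx, norm_zero, zero_pow two_ne_zero, hasSum_zero_iff_of_nonneg fun n =>
    mul_nonneg (hl n).le (by positivity)] at h1
  have h2 : ∀ n, ‖inner ℂ (b n) x‖ ^ 2 = 0 := fun n => by
    simpa [(hl n).ne'] using congrFun h1 n
  have h3 := hasSum_hilbertBasis_inner_sq b x
  simp only [h2] at h3
  simpa using h3.unique hasSum_zero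

/-- Only the quadratic form `‖D x‖² = ∑ l_n |x_n|²` and self-adjointness are available, not the
action of `D` on the basis. Necessity comes from testing `y = D h` against finite sums; sufficiency
from a weighted Cauchy–Schwarz inequality and `exists_adjoint_eq_of_bound`. -/
theorem mem_range_iff_of_hasSum_diagonal [CompleteSpace H]
    (hl : ∀ n, 0 < l n)
    (hD : ∀ x, HasSum (fun n => l n * ‖inner ℂ (b n) x‖ ^ 2) (‖D x‖ ^ 2))
    (hsa : IsSelfAdjoint D) (y : H) :
    (∃ x, D x = y) ↔ Summable fun n => ‖inner ℂ (b n) y‖ ^ 2 / l n := by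
  constructor
  · rintro ⟨h, rfl⟩
    set y := D h with hy
    refine summable_of_sum_range_le (c := ‖h‖ ^ 2) (fun n => div_nonneg (by positivity)
      (hl n).le) fun N => ?_
    set t := ∑ n ∈ Finset.range N, ‖inner ℂ (b n) y‖ ^ 2 / l n with ht
    have ht0 : 0 ≤ t := Finset.sum_nonneg fun n _ => div_nonneg (by positivity) (hl n).le
    -- The coefficients `y_n / l_n` are chosen so that `⟨x, y⟩` and `‖D x‖²` both equal the partial
    -- sum `t`.
    set x : H := ∑ n ∈ Finset.range N, (inner ℂ (b n) y / l n) • b n with hx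
    have hxn := inner_hilbertBasis_sum b (fun n => inner ℂ (b n) y / l n) N
    have h1 : inner ℂ x y = (t : ℂ) := by
      rw [hx, sum_inner, ht, Complex.ofReal_sum]
      refine Finset.sum_congr rfl fun n _ => ?_
      rw [inner_smul_left, map_div₀, Complex.conj_ofReal, div_mul_eq_mul_div,
        Complex.conj_mul']
      push_cast
      rfl
    have h2 : ‖D x‖ ^ 2 = t := by
      refine (hD x).unique ?_
      have h3 : ∀ n ∉ Finset.range N, l n * ‖inner ℂ (b n) x‖ ^ 2 = 0 := by
        intro n hn
        rw [hxn, if_neg (by simpa using hn)]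
        simp
      have h5 := hasSum_sum_of_ne_finset_zero (L := SummationFilter.unconditional ℕ) h3
      have h6 : ∑ n ∈ Finset.range N, l n * ‖inner ℂ (b n) x‖ ^ 2 = t := by
        refine Finset.sum_congr rfl fun n hn => ?_
        have h4 := hl n
        rw [hxn, if_pos (by simpa using hn), norm_div, Complex.norm_real,
          Real.norm_of_nonneg h4.le]
        field_simp
      rwa [h6] at h5
    have h5 : ‖inner ℂ x y‖ ≤ ‖D x‖ * ‖h‖ := by
      rw [hy, ← ContinuousLinearMap.adjoint_inner_left, hsa.adjoint_eq]
      exact norm_inner_le_norm _ _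
    rw [h1, Complex.norm_real, Real.norm_of_nonneg ht0] at h5
    -- From `t ≤ ‖D x‖ ‖h‖` follows `2t ≤ ‖D x‖² + ‖h‖² = t + ‖h‖²`.
    nlinarith [norm_nonneg h, norm_nonneg (D x), sq_nonneg (‖D x‖ - ‖h‖)]
  · intro hs
    obtain ⟨v, hv⟩ := exists_adjoint_eq_of_bound D y
      (√(∑' n, ‖inner ℂ (b n) y‖ ^ 2 / l n)) fun x => by
        have h1 := b.hasSum_inner_mul_inner y x
        -- Cauchy–Schwarz after writing `|y_n| |x_n|` as `(|y_n| / √l_n) (√l_n |x_n|)`.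
        obtain ⟨C, -, hC, hsum⟩ := Real.inner_le_Lp_mul_Lq_hasSum_of_nonneg (p := 2) (q := 2)
          (f := fun n => ‖inner ℂ (b n) y‖ / √(l n))
          (g := fun n => √(l n) * ‖inner ℂ (b n) x‖)
          (A := √(∑' n, ‖inner ℂ (b n) y‖ ^ 2 / l n)) (B := ‖D x‖)
          (by constructor <;> norm_num) (Real.sqrt_nonneg _) (norm_nonneg _)
          (fun n => by positivity) (fun n => by positivity)
          (by
            rw [Real.rpow_ofNat, Real.sq_sqrt (tsum_nonneg fun n => div_nonneg (by positivity)
              (hl n).le)]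
            simp only [Real.rpow_ofNat, div_pow, Real.sq_sqrt (hl _).le]
            exact hs.hasSum)
          (by
            simp only [Real.rpow_ofNat, mul_pow, Real.sq_sqrt (hl _).le]
            exact hD x)
        refine le_trans ?_ hC
        rw [← h1.tsum_eq]
        have h4 : ∀ n, ‖inner ℂ (b n) y‖ / √(l n) * (√(l n) * ‖inner ℂ (b n) x‖) =
            ‖inner ℂ y (b n) * inner ℂ (b n) x‖ := by
          intro n
          have := (Real.sqrt_pos.2 (hl n)).ne'
          rw [norm_mul, norm_inner_symm y]
          field_simp
        simp only [h4] at hsum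
        rw [← hsum.tsum_eq]
        exact norm_tsum_le_tsum_norm hsum.summable
    exact ⟨v, by rwa [hsa.adjoint_eq] at hv⟩

/-- `D` is the norm limit of the finite-rank operators `D P_N`, where `P_N` projects onto the first
`N` basis vectors: by monotonicity of `l`, the error is at most `√l_N`. -/
theorem isCompactOperator_of_hasSum_diagonal [CompleteSpace H]
    (hl : ∀ n, 0 < l n)
    (hD : ∀ x, HasSum (fun n => l n * ‖inner ℂ (b n) x‖ ^ 2) (‖D x‖ ^ 2))
    (hanti : Antitone l) (hlim : Tendsto l atTop (𝓝 0)) :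
    IsCompactOperator D := by
  let P : ℕ → H →L[ℂ] H := fun N => ∑ n ∈ Finset.range N, (innerSL ℂ (b n)).smulRight (b n)
  have hP : ∀ N x, P N x = ∑ n ∈ Finset.range N, inner ℂ (b n) x • b n := by
    intro N x
    simp [P]
  have hbound : ∀ N x, ‖(D - D * P N) x‖ ≤ √(l N) * ‖x‖ := by
    intro N x
    have h0 : (D - D * P N) x = D (x - P N x) := by simp
    rw [h0]
    refine le_of_sq_le_sq ?_ (by positivity)
    rw [mul_pow, Real.sq_sqrt (hl N).le]
    refine hasSum_le (fun n => ?_) (hD (x - P N x))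
      ((hasSum_hilbertBasis_inner_sq b x).mul_left (l N))
    rw [inner_sub_right, hP, inner_hilbertBasis_sum]
    split_ifs with h
    · have := (hl N).le
      rw [sub_self, norm_zero, zero_pow two_ne_zero, mul_zero]
      positivity
    · rw [sub_zero]
      exact mul_le_mul_of_nonneg_right (hanti (not_lt.1 h)) (by positivity)
  have htend : Tendsto (fun N => D * P N) atTop (𝓝 D) := by
    rw [tendsto_iff_norm_sub_tendsto_zero]
    have h1 : Tendsto (fun N => √(l N)) atTop (𝓝 0) := by
      rw [← Real.sqrt_zero]
      exact (Real.continuous_sqrt.tendsto 0).comp hlim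
    refine squeeze_zero (fun _ => norm_nonneg _) (fun N => ?_) h1
    rw [norm_sub_rev]
    exact ContinuousLinearMap.opNorm_le_bound _ (Real.sqrt_nonneg _) (hbound N)
  refine isCompactOperator_of_tendsto htend (Eventually.of_forall fun N => ?_)
  have hfin : IsCompactOperator (P N) := by
    have h1 : (⇑(P N) : H → H) = ⇑(∑ n ∈ Finset.range N,
      (innerSL ℂ (b n)).smulRight (b n)) := rfl
    rw [h1]
    refine (compactOperator (RingHom.id ℂ) H H).sum_mem fun n _ => ?_
    exact (isCompactOperator_of_locallyCompactSpace_rng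
      (ContinuousLinearMap.toSpanSingleton ℂ (b n))).comp_clm (innerSL ℂ (b n))
  exact hfin.clm_comp D

end Diagonal

/-! ### The defect operator of the shift -/

theorem memHInftyBall_id : MemHInftyBall fun z => z :=
  ⟨differentiableOn_id, fun z hz => by simpa using (mem_ball_zero_iff.1 hz).le⟩

theorem moment_sqrt_ratio (hα : -1 < α) (n : ℕ) :
    (√(moment α (n + 1)) / √(moment α n)) ^ 2 = 1 - shiftEigenvalue α (n + 1) := by
  have h := moment_pos hα n
  rw [div_pow, Real.sq_sqrt (moment_pos hα _).le, Real.sq_sqrt h.le, moment_succ hα,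
    mul_div_cancel_left₀ _ h.ne']

theorem mulOp_id_monomial (hα : -1 < α) (n : ℕ) :
    mulOp α memHInftyBall_id (monomial hα n) =
      ((√(moment α (n + 1)) / √(moment α n) : ℝ) : ℂ) • monomial hα (n + 1) := by
  refine bergman_ext fun z hz => ?_
  rw [rep_mulOp _ _ z hz, rep_smul _ _ z hz, rep_monomial hα _ z hz, rep_monomial hα _ z hz]
  have h2 : (√(moment α (n + 1)) : ℂ) ≠ 0 := by
    exact_mod_cast (Real.sqrt_pos.2 (moment_pos hα (n + 1))).ne'
  have h3 : (√(moment α n) : ℂ) ≠ 0 := by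
    exact_mod_cast (Real.sqrt_pos.2 (moment_pos hα n)).ne'
  push_cast
  field_simp
  ring

/-- `T_z*` is a backward weighted shift: its `n`-th coefficient at `f` has squared modulus `(1 -
λ_{n+1}) |f_{n+1}|²`. Subtracting the sum of these from `‖f‖²` leaves `∑ λ_n |f_n|²`. -/
theorem hasSum_defectOp_id (hα : -1 < α) (f : bergman α) :
    HasSum (fun n => shiftEigenvalue α n * ‖normCoeff f n‖ ^ 2)
      (‖defectOp α memHInftyBall_id f‖ ^ 2) := by
  rw [defectOp, norm_defect_sq (norm_mulOp_le _)]
  have h1 := hasSum_normCoeff_sq hα (ContinuousLinearMap.adjoint (mulOp α memHInftyBall_id) f)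
  have h2 : ∀ n, ‖normCoeff (ContinuousLinearMap.adjoint (mulOp α memHInftyBall_id) f) n‖ ^ 2 =
      (1 - shiftEigenvalue α (n + 1)) * ‖normCoeff f (n + 1)‖ ^ 2 := by
    intro n
    have h3 := inner_smul_left (𝕜 := ℂ) (monomial hα (n + 1)) f
      ((√(moment α (n + 1)) / √(moment α n) : ℝ) : ℂ)
    rw [← inner_monomial hα, ContinuousLinearMap.adjoint_inner_right, mulOp_id_monomial,
      h3, inner_monomial, norm_mul, mul_pow, RCLike.norm_conj, Complex.norm_real,
      Real.norm_eq_abs, sq_abs, moment_sqrt_ratio hα]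
  simp only [h2] at h1
  -- The reindexed sum acquires a term `n = 0`, which vanishes because `λ_0 = 1`.
  have h3 := (hasSum_nat_add_iff (f := fun n => (1 - shiftEigenvalue α n) * ‖normCoeff f n‖ ^ 2)
    1).1 h1
  simp only [Finset.range_one, Finset.sum_singleton, shiftEigenvalue_zero hα, sub_self, zero_mul,
    add_zero] at h3
  have h4 := (hasSum_normCoeff_sq hα f).sub h3
  have h5 : ∀ x y : ℝ, y - (1 - x) * y = x * y := fun x y => by ring
  simpa only [h5] using h4

theorem hasSum_defectOp_id_inner (hα : -1 < α) (f : bergman α) :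
    HasSum (fun n => shiftEigenvalue α n * ‖inner ℂ (monomialBasis hα n) f‖ ^ 2)
      (‖defectOp α memHInftyBall_id f‖ ^ 2) := by
  simpa only [coe_monomialBasis, inner_monomial] using hasSum_defectOp_id hα f

theorem defectOp_id_injective (hα : -1 < α) :
    Function.Injective (defectOp α memHInftyBall_id) :=
  injective_of_hasSum_diagonal (monomialBasis hα) (shiftEigenvalue_pos hα)
    (hasSum_defectOp_id_inner hα)

theorem mem_range_defectOp_id_iff (hα : -1 < α) (f : bergman α) :
    (∃ h, defectOp α memHInftyBall_id h = f) ↔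
      Summable fun n => ‖normCoeff f n‖ ^ 2 / shiftEigenvalue α n := by
  have := mem_range_iff_of_hasSum_diagonal (monomialBasis hα) (shiftEigenvalue_pos hα)
    (hasSum_defectOp_id_inner hα) (defect_isSelfAdjoint _) f
  simpa only [coe_monomialBasis, inner_monomial] using this

theorem antitone_shiftEigenvalue (hα : -1 < α) : Antitone (shiftEigenvalue α) := by
  intro m n hmn
  have h1 : (m : ℝ) ≤ n := by exact_mod_cast hmn
  have h2 : (0 : ℝ) ≤ m := m.cast_nonneg
  exact div_le_div_of_nonneg_left (by linarith) (by linarith) (by linarith)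

theorem tendsto_shiftEigenvalue : Tendsto (shiftEigenvalue α) atTop (𝓝 0) :=
  Tendsto.div_atTop tendsto_const_nhds (tendsto_atTop_add_const_right _ _
    (tendsto_atTop_add_const_right _ _ tendsto_natCast_atTop_atTop))

theorem isCompactOperator_defectOp_id (hα : -1 < α) :
    IsCompactOperator (defectOp α memHInftyBall_id) :=
  isCompactOperator_of_hasSum_diagonal (monomialBasis hα) (shiftEigenvalue_pos hα)
    (hasSum_defectOp_id_inner hα) (antitone_shiftEigenvalue hα) tendsto_shiftEigenvalue

/-! ### Reproducing kernels -/

theorem exists_kernel (w : ℂ) (hw : w ∈ disk) :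
    ∃ K : bergman α, ∀ f, inner ℂ K f = rep f w := by
  obtain ⟨C, hC⟩ := eval_bound α (show ‖w‖ < 1 by simpa using hw)
  let E : bergman α →ₗ[ℂ] ℂ :=
    { toFun := fun f => rep f w
      map_add' := fun f g => rep_add f g w hw
      map_smul' := fun c f => rep_smul c f w hw }
  have hE : ∀ f, ‖E f‖ ≤ C * ‖f‖ := by
    intro f
    have h1 := hC (rep f) (differentiableOn_rep f) w le_rfl
    rw [← eLpNorm_congr_ae (coeFn_ae_eq_rep f), ← Lp.enorm_def, ← ofReal_norm, ← ofReal_norm,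
      ← ENNReal.ofReal_coe_nnreal, ← ENNReal.ofReal_mul C.coe_nonneg] at h1
    exact (ENNReal.ofReal_le_ofReal_iff (by positivity)).1 h1
  refine ⟨(InnerProductSpace.toDual ℂ (bergman α)).symm (E.mkContinuous C hE), fun f => ?_⟩
  rw [InnerProductSpace.toDual_symm_apply]
  rfl

theorem adjoint_mulOp_kernel {φ : ℂ → ℂ} (hφ : MemHInftyBall φ) {w : ℂ} (hw : w ∈ disk)
    {K : bergman α} (hK : ∀ f, inner ℂ K f = rep f w) :
    ContinuousLinearMap.adjoint (mulOp α hφ) K = conj (φ w) • K := by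
  refine ext_inner_right ℂ fun f => ?_
  have h := inner_smul_left (𝕜 := ℂ) K f (conj (φ w))
  rw [ContinuousLinearMap.adjoint_inner_left, hK, rep_mulOp hφ f w hw, h, hK, Complex.conj_conj]

theorem norm_defectOp_kernel_sq {φ : ℂ → ℂ} (hφ : MemHInftyBall φ) {w : ℂ} (hw : w ∈ disk)
    {K : bergman α} (hK : ∀ f, inner ℂ K f = rep f w) :
    ‖defectOp α hφ K‖ ^ 2 = (1 - ‖φ w‖ ^ 2) * ‖K‖ ^ 2 := by
  rw [defectOp, norm_defect_sq (norm_mulOp_le _), adjoint_mulOp_kernel hφ hw hK, norm_smul,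
    RCLike.norm_conj]
  ring

/-- `‖K‖²` is the sum of the `|w|^{2n}` divided by the moments, and the moments are at most `1`, so
a geometric series bounds it below. Blow-up at the circle is all that is needed, not the exact norm.
-/
theorem norm_kernel_sq_ge (hα : -1 < α) {w : ℂ} (hw : w ∈ disk)
    {K : bergman α} (hK : ∀ f, inner ℂ K f = rep f w) :
    (1 - ‖w‖ ^ 2)⁻¹ ≤ ‖K‖ ^ 2 := by
  have h1 := hasSum_normCoeff_sq hα K
  have hw1 : ‖w‖ < 1 := by simpa using hw
  have h2 := hasSum_geometric_of_lt_one (r := ‖w‖ ^ 2) (by positivity) (by nlinarith [norm_nonneg w])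
  refine hasSum_le (fun n => ?_) h2 h1
  have h3 := norm_inner_symm (𝕜 := ℂ) (monomial hα n) K
  rw [← inner_monomial hα, h3, hK, rep_monomial hα n w hw, norm_mul,
    Complex.norm_real, norm_pow, mul_pow, Real.norm_eq_abs, sq_abs, inv_pow,
    Real.sq_sqrt (moment_pos hα n).le, ← pow_mul, ← pow_mul, mul_comm n]
  exact le_mul_of_one_le_left (by positivity)
    ((one_le_inv₀ (moment_pos hα n)).2 (moment_le_one hα n))

/-! ### The space `A²_{α-1}` as the range of the defect operator of the shift -/

theorem bergmanOrder_of_pos (hα : 0 < α) : bergmanOrder (α - 1) = 0 := by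
  rw [bergmanOrder, Nat.sInf_eq_zero]
  left
  simp only [mem_ofPred_eq, Nat.cast_zero]
  linarith

theorem bergmanOrder_of_nonpos (hα : -1 < α) (hα0 : α ≤ 0) : bergmanOrder (α - 1) = 1 := by
  have h1 : (1 : ℕ) ∈ {k : ℕ | -1 < 2 * (k : ℝ) + (α - 1)} := by
    simp only [mem_ofPred_eq, Nat.cast_one]
    linarith
  refine le_antisymm (Nat.sInf_le h1) (Nat.one_le_iff_ne_zero.2 fun h0 => ?_)
  have h2 := Nat.sInf_mem ⟨1, h1⟩
  rw [show sInf _ = 0 from h0, mem_ofPred_eq, Nat.cast_zero] at h2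
  linarith

theorem ofReal_mul_norm_sq {x : ℝ} (hx : 0 ≤ x) (a : ℂ) :
    ENNReal.ofReal (x * ‖a‖ ^ 2) = ENNReal.ofReal x * ‖a‖ₑ ^ 2 := by
  rw [ENNReal.ofReal_mul hx, ENNReal.ofReal_pow (norm_nonneg _), ofReal_norm]

theorem one_sub_norm_sq_pos {z : ℂ} (hz : z ∈ disk) : 0 < 1 - ‖z‖ ^ 2 := by
  have h1 : ‖z‖ < 1 := by simpa using hz
  nlinarith [norm_nonneg z]

theorem mem_genBergman_iff_of_pos (hα : 0 < α) (f : ℂ → ℂ) :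
    f ∈ genBergman (α - 1) ↔
      DifferentiableOn ℂ f disk ∧ ∫⁻ z, ‖f z‖ₑ ^ 2 ∂areaMeasure (α - 1) < ∞ := by
  rw [genBergman, mem_ofPred_eq, bergmanOrder_of_pos hα]
  simp [ENNReal.ofReal_pow]

/-- Here `α - 1 ≤ -1`, so the normalizing constant is the default `1` and one derivative enters; the
exponents add up to `(α - 1) + 2 = α + 1`. -/
theorem mem_genBergman_iff_of_nonpos (hα : -1 < α) (hα0 : α ≤ 0) (f : ℂ → ℂ) :
    f ∈ genBergman (α - 1) ↔ DifferentiableOn ℂ f disk ∧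
      ∫⁻ z in disk, ENNReal.ofReal (1 / Real.pi * (1 - ‖z‖ ^ 2) ^ (α + 1)) * ‖deriv f z‖ₑ ^ 2 <
        ∞ := by
  rw [genBergman, mem_ofPred_eq, bergmanOrder_of_nonpos hα hα0, lintegral_areaMeasure,
    setLIntegral_congr_fun measurableSet_ball]
  intro z hz
  have h1 := one_sub_norm_sq_pos hz
  have h2 := weight_pos (α - 1) hz
  have h3 : (1 - ‖z‖ ^ 2) ^ (α - 1) * (1 - ‖z‖ ^ 2) ^ 2 = (1 - ‖z‖ ^ 2) ^ (α + 1) := by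
    rw [← Real.rpow_natCast (1 - ‖z‖ ^ 2) 2, ← Real.rpow_add h1]
    congr 1
    push_cast
    ring
  simp only
  rw [iteratedDeriv_one, ofReal_mul_norm_sq (by positivity), ← mul_assoc,
    ← ENNReal.ofReal_mul h2.le, weight, normConst, if_neg (by linarith), mul_one, mul_assoc, h3]

/-- For `α > 0` the range condition for the shift defect is therefore exactly finiteness of the norm
of `A²_{α-1}`, with no loss of constants. -/
theorem moment_div_shiftEigenvalue (hα : 0 < α) (n : ℕ) :
    moment α n / shiftEigenvalue α n = moment (α - 1) n := by
  have h0 : (0 : ℝ) ≤ n := n.cast_nonneg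
  have h1 : (n : ℝ) + 1 + α ≠ 0 := by linarith
  have h2 : (n : ℝ) + α + 1 ≠ 0 := by linarith
  have h3 : α + 1 ≠ 0 := by linarith
  rw [moment, moment, beta_add_one_right (by linarith) hα, shiftEigenvalue, sub_add_cancel]
  field_simp
  ring

theorem sq_mul_beta (hα : -1 < α) (n : ℕ) :
    (n + 1 : ℝ) ^ 2 * ProbabilityTheory.beta (n + 1) (α + 1 + 1) =
      (n + 1) * moment α (n + 1) := by
  have h0 : (0 : ℝ) ≤ n := n.cast_nonneg
  have h1 : (n : ℝ) + 1 + (α + 1) ≠ 0 := by linarith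
  rw [moment, Nat.cast_succ, beta_add_one_left (a := (n : ℝ) + 1) (by linarith) (by linarith),
    beta_add_one_right (a := (n : ℝ) + 1) (b := α + 1) (by linarith) (by linarith)]
  field_simp

/-- For `α ≤ 0` the integral of the derivative weights the `n`-th coefficient by `n` times the
moment, while dividing the moment by `λ_n` multiplies it by `n/(α+1) + 1`. The two are comparable
for `n ≥ 1`, and the term `n = 0` is always finite. -/
theorem mem_genBergman_iff_tsum (hα : -1 < α) {f : ℂ → ℂ} (hf : DifferentiableOn ℂ f disk) :
    f ∈ genBergman (α - 1) ↔ ∑' n, ‖taylorCoeff f n‖ₑ ^ 2 *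
      ENNReal.ofReal (moment α n / shiftEigenvalue α n) < ∞ := by
  rcases lt_or_ge 0 α with h | h
  · rw [mem_genBergman_iff_of_pos h, and_iff_right hf,
      lintegral_enorm_sq_areaMeasure (by linarith) hf]
    simp only [moment_div_shiftEigenvalue h]
  · have hf' : DifferentiableOn ℂ (deriv f) disk := hf.deriv Metric.isOpen_ball
    rw [mem_genBergman_iff_of_nonpos hα h, and_iff_right hf,
      lintegral_disk_weight hf' (by linarith) zero_le_one]
    have h1 : ∀ n : ℕ, ‖taylorCoeff (deriv f) n‖ₑ ^ 2 *
        ENNReal.ofReal (1 * ProbabilityTheory.beta (n + 1) (α + 1 + 1)) =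
        ‖taylorCoeff f (n + 1)‖ₑ ^ 2 * ENNReal.ofReal ((n + 1) * moment α (n + 1)) := by
      intro n
      have h2 : ‖(n + 1 : ℂ)‖ₑ = ENNReal.ofReal (n + 1) := by
        rw [← ofReal_norm]
        congr 1
        exact_mod_cast Complex.norm_natCast (n + 1)
      rw [taylorCoeff_deriv, enorm_mul, mul_pow, h2, one_mul, ← sq_mul_beta hα,
        ENNReal.ofReal_mul (by positivity), ENNReal.ofReal_pow (by positivity)]
      ring
    simp only [h1]
    have hsplit : ∑' n, ‖taylorCoeff f n‖ₑ ^ 2 *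
        ENNReal.ofReal (moment α n / shiftEigenvalue α n) = ‖taylorCoeff f 0‖ₑ ^ 2 *
        ENNReal.ofReal (moment α 0 / shiftEigenvalue α 0) + ∑' n, ‖taylorCoeff f (n + 1)‖ₑ ^ 2 *
        ENNReal.ofReal (moment α (n + 1) / shiftEigenvalue α (n + 1)) :=
      tsum_eq_zero_add' ENNReal.summable
    have hz : ‖taylorCoeff f 0‖ₑ ^ 2 * ENNReal.ofReal (moment α 0 / shiftEigenvalue α 0) < ∞ :=
      ENNReal.mul_lt_top (by simp) ENNReal.ofReal_lt_top
    rw [hsplit, ENNReal.add_lt_top, and_iff_right hz]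
    have ha : 0 < α + 1 := by linarith
    have hq : ∀ n : ℕ, moment α (n + 1) / shiftEigenvalue α (n + 1) =
        ((n + 1) / (α + 1) + 1) * moment α (n + 1) := by
      intro n
      have h0 : (0 : ℝ) ≤ n := n.cast_nonneg
      have h3 : (n : ℝ) + 1 + α + 1 ≠ 0 := by linarith
      rw [shiftEigenvalue, Nat.cast_succ]
      field_simp
      ring
    constructor
    · intro hfin
      -- The constant comes from `(n+1)/(α+1) + 1 ≤ (n+1) (1/(α+1) + 1)`; the converse direction
      -- uses the factor `α + 1` and `n + 1 ≤ n + 1 + (α + 1)`.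
      refine lt_of_le_of_lt ?_ (ENNReal.mul_lt_top hfin
        (ENNReal.ofReal_lt_top (r := 1 / (α + 1) + 1)))
      rw [← ENNReal.tsum_mul_right]
      refine ENNReal.tsum_le_tsum fun n => ?_
      have h0 : (0 : ℝ) ≤ n := n.cast_nonneg
      have hm := moment_pos hα (n + 1)
      rw [mul_assoc, ← ENNReal.ofReal_mul (by positivity), hq]
      refine mul_le_mul' le_rfl (ENNReal.ofReal_le_ofReal ?_)
      have h4 : (n + 1) * moment α (n + 1) * (1 / (α + 1) + 1) =
        ((n + 1) / (α + 1) + (n + 1)) * moment α (n + 1) := by ring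
      rw [h4]
      gcongr
      linarith
    · intro hfin
      refine lt_of_le_of_lt ?_ (ENNReal.mul_lt_top hfin (ENNReal.ofReal_lt_top (r := α + 1)))
      rw [← ENNReal.tsum_mul_right]
      refine ENNReal.tsum_le_tsum fun n => ?_
      have h0 : (0 : ℝ) ≤ n := n.cast_nonneg
      have hm := moment_pos hα (n + 1)
      rw [mul_assoc, ← ENNReal.ofReal_mul (by rw [hq]; positivity), hq]
      refine mul_le_mul' le_rfl (ENNReal.ofReal_le_ofReal ?_)
      have h4 : ((n + 1) / (α + 1) + 1) * moment α (n + 1) * (α + 1) =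
          (n + 1 + (α + 1)) * moment α (n + 1) := by
        field_simp
      rw [h4]
      exact mul_le_mul_of_nonneg_right (by linarith) hm.le

theorem rep_mem_genBergman_iff (hα : -1 < α) (f : bergman α) :
    rep f ∈ genBergman (α - 1) ↔ ∃ h, defectOp α memHInftyBall_id h = f := by
  rw [mem_range_defectOp_id_iff hα, mem_genBergman_iff_tsum hα (differentiableOn_rep f)]
  have h1 : ∀ n, ‖taylorCoeff (rep f) n‖ₑ ^ 2 *
      ENNReal.ofReal (moment α n / shiftEigenvalue α n) =
      ENNReal.ofReal (‖normCoeff f n‖ ^ 2 / shiftEigenvalue α n) := by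
    intro n
    rw [div_eq_mul_inv, div_eq_mul_inv, ENNReal.ofReal_mul (moment_pos hα n).le, ← mul_assoc,
      ← enorm_normCoeff_sq hα, ENNReal.ofReal_mul (by positivity),
      ENNReal.ofReal_pow (norm_nonneg _), ofReal_norm]
  have h2 : ∀ n, 0 ≤ ‖normCoeff f n‖ ^ 2 / shiftEigenvalue α n := fun n =>
    div_nonneg (by positivity) (shiftEigenvalue_pos hα n).le
  simp only [h1]
  constructor
  · intro h
    refine (ENNReal.summable_toReal h.ne).congr fun n => ?_
    rw [ENNReal.toReal_ofReal (h2 n)]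
  · intro h
    rw [← ENNReal.ofReal_tsum_of_nonneg h2 h]
    exact ENNReal.ofReal_lt_top

theorem shiftEigenvalue_le_one (hα : -1 < α) (n : ℕ) : shiftEigenvalue α n ≤ 1 :=
  (antitone_shiftEigenvalue hα n.zero_le).trans (shiftEigenvalue_zero hα).le

theorem exists_rep_eq_of_mem_genBergman (hα : -1 < α) {f : ℂ → ℂ} (hf : f ∈ genBergman (α - 1)) :
    ∃ F : bergman α, ∀ z ∈ disk, rep F z = f z := by
  refine exists_rep_eq hf.1 ?_
  rw [lintegral_enorm_sq_areaMeasure hα hf.1]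
  refine lt_of_le_of_lt (ENNReal.tsum_le_tsum fun n => ?_) ((mem_genBergman_iff_tsum hα hf.1).1 hf)
  gcongr
  exact le_div_self (moment_pos hα n).le (shiftEigenvalue_pos hα n) (shiftEigenvalue_le_one hα n)

theorem genBergman_congr (hα : -1 < α) {f g : ℂ → ℂ} (hf : DifferentiableOn ℂ f disk)
    (hg : DifferentiableOn ℂ g disk) (h : ∀ z ∈ disk, f z = g z) :
    f ∈ genBergman (α - 1) ↔ g ∈ genBergman (α - 1) := by
  rw [mem_genBergman_iff_tsum hα hf, mem_genBergman_iff_tsum hα hg]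
  simp only [taylorCoeff_congr h]

theorem mem_subBergman_iff {φ : ℂ → ℂ} (hφ : MemHInftyBall φ) {f : ℂ → ℂ} :
    f ∈ subBergman α hφ ↔ DifferentiableOn ℂ f disk ∧
      ∃ h : bergman α, ∀ z ∈ disk, rep (defectOp α hφ h) z = f z :=
  and_congr_right fun hf => exists_congr fun _ => ⟨rep_eq_of_ae_eq hf, ae_eq_of_rep_eq⟩

theorem subBergman_subset_iff {φ ψ : ℂ → ℂ} (hφ : MemHInftyBall φ) (hψ : MemHInftyBall ψ) :
    subBergman α hφ ⊆ subBergman α hψ ↔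
      ∀ h, ∃ k, defectOp α hψ k = defectOp α hφ h := by
  constructor
  · intro hsub h
    obtain ⟨-, k, hk⟩ := (mem_subBergman_iff hψ).1 (hsub ((mem_subBergman_iff hφ).2
      ⟨differentiableOn_rep (defectOp α hφ h), h, fun _ _ => rfl⟩))
    exact ⟨k, bergman_ext hk⟩
  · intro hsub f hf
    obtain ⟨hd, h, hh⟩ := (mem_subBergman_iff hφ).1 hf
    obtain ⟨k, hk⟩ := hsub h
    exact (mem_subBergman_iff hψ).2 ⟨hd, k, by rwa [hk]⟩

theorem subBergman_id (hα : -1 < α) :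
    subBergman α memHInftyBall_id = genBergman (α - 1) := by
  ext f
  rw [mem_subBergman_iff]
  constructor
  · rintro ⟨hf, h, hh⟩
    rw [← genBergman_congr hα (differentiableOn_rep _) hf hh]
    exact (rep_mem_genBergman_iff hα _).2 ⟨h, rfl⟩
  · intro hf
    obtain ⟨F, hF⟩ := exists_rep_eq_of_mem_genBergman hα hf
    obtain ⟨h, rfl⟩ := (rep_mem_genBergman_iff hα F).1
      ((genBergman_congr hα (differentiableOn_rep _) hf.1 hF).2 hf)
    exact ⟨hf.1, h, hF⟩

/-! ### Multipliers of `A²_{α-1}` -/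

/-- For `α > 0` the bound `|g| ≤ 1` suffices. For `α ≤ 0`, in `(g f)' = g' f + g f'` the first term
is harmless because `f` lies in `A²_α` and `(1-|z|²)^{α+1} ≤ (1-|z|²)^α`. -/
theorem mul_rep_mem_genBergman (hα : -1 < α) {g : ℂ → ℂ} (hg : MemHInftyBall g) {C : ℝ}
    (hg' : ∀ z ∈ disk, ‖deriv g z‖ ≤ C) {f : bergman α} (hf : rep f ∈ genBergman (α - 1)) :
    (fun z => g z * rep f z) ∈ genBergman (α - 1) := by
  have hdiff : DifferentiableOn ℂ (fun z => g z * rep f z) disk :=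
    hg.differentiableOn.mul hf.1
  rcases lt_or_ge 0 α with h | h
  · rw [mem_genBergman_iff_of_pos h] at hf ⊢
    refine ⟨hdiff, lt_of_le_of_lt (lintegral_mono_ae ?_) hf.2⟩
    filter_upwards [ae_mem_disk (α - 1)] with z hz
    rw [enorm_mul]
    gcongr
    refine mul_le_of_le_one_left' ?_
    rw [← ofReal_norm, ENNReal.ofReal_le_one]
    exact hg.norm_le_one z hz
  · rw [mem_genBergman_iff_of_nonpos hα h] at hf ⊢
    refine ⟨hdiff, ?_⟩
    have hfin : ∫⁻ z in disk, ENNReal.ofReal (weight α z) * ‖rep f z‖ₑ ^ 2 < ∞ := by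
      rw [← lintegral_areaMeasure, ← enorm_sq_eq_lintegral, ← ofReal_norm]
      exact ENNReal.pow_lt_top ENNReal.ofReal_lt_top
    -- The factor `2 C²` comes from `(x+y)² ≤ 2x² + 2y²`; dividing by `α + 1` cancels the
    -- normalization of the weight.
    set c : ℝ := 2 * C ^ 2 / (α + 1) with hc
    have ha : 0 < α + 1 := by linarith
    have hbound : ∀ z ∈ disk, ENNReal.ofReal (1 / Real.pi * (1 - ‖z‖ ^ 2) ^ (α + 1)) *
        ‖deriv (fun z => g z * rep f z) z‖ₑ ^ 2 ≤
        2 * (ENNReal.ofReal (1 / Real.pi * (1 - ‖z‖ ^ 2) ^ (α + 1)) * ‖deriv (rep f) z‖ₑ ^ 2) +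
        ENNReal.ofReal c * (ENNReal.ofReal (weight α z) * ‖rep f z‖ₑ ^ 2) := by
      intro z hz
      have h1 := one_sub_norm_sq_pos hz
      have h2 : (1 - ‖z‖ ^ 2) ^ (α + 1) ≤ (1 - ‖z‖ ^ 2) ^ α :=
        Real.rpow_le_rpow_of_exponent_ge h1 (by nlinarith [norm_nonneg z]) (by linarith)
      have h3 : 0 ≤ (1 - ‖z‖ ^ 2) ^ (α + 1) := Real.rpow_nonneg h1.le _
      have hpi := Real.pi_pos
      have hw := (weight_pos α hz).le
      have hd : deriv (fun z => g z * rep f z) z = deriv g z * rep f z + g z * deriv (rep f) z :=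
        deriv_fun_mul (hg.differentiableOn.differentiableAt (Metric.isOpen_ball.mem_nhds hz))
          (hf.1.differentiableAt (Metric.isOpen_ball.mem_nhds hz))
      have h4 : ‖deriv (fun z => g z * rep f z) z‖ ^ 2 ≤
          2 * ‖deriv (rep f) z‖ ^ 2 + 2 * C ^ 2 * ‖rep f z‖ ^ 2 := by
        have h5 : ‖deriv (fun z => g z * rep f z) z‖ ≤ C * ‖rep f z‖ + ‖deriv (rep f) z‖ := by
          rw [hd]
          refine (norm_add_le _ _).trans (add_le_add ?_ ?_)
          · rw [norm_mul]
            exact mul_le_mul_of_nonneg_right (hg' z hz) (norm_nonneg _)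
          · rw [norm_mul]
            exact mul_le_of_le_one_left (norm_nonneg _) (hg.norm_le_one z hz)
        have h6 := pow_le_pow_left₀ (norm_nonneg _) h5 2
        nlinarith [sq_nonneg (C * ‖rep f z‖ - ‖deriv (rep f) z‖)]
      have h7 : 2 * (ENNReal.ofReal (1 / Real.pi * (1 - ‖z‖ ^ 2) ^ (α + 1)) *
          ‖deriv (rep f) z‖ₑ ^ 2) =
          ENNReal.ofReal (2 * (1 / Real.pi * (1 - ‖z‖ ^ 2) ^ (α + 1) * ‖deriv (rep f) z‖ ^ 2)) := by
        rw [ENNReal.ofReal_mul zero_le_two, ofReal_mul_norm_sq (by positivity),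
          ENNReal.ofReal_ofNat]
      rw [h7, ← ofReal_mul_norm_sq (by positivity), ← ofReal_mul_norm_sq hw,
        ← ENNReal.ofReal_mul (by positivity), ← ENNReal.ofReal_add (by positivity) (by positivity)]
      refine ENNReal.ofReal_le_ofReal ?_
      have h8 : c * (weight α z * ‖rep f z‖ ^ 2) =
          1 / Real.pi * (1 - ‖z‖ ^ 2) ^ α * (2 * C ^ 2 * ‖rep f z‖ ^ 2) := by
        rw [hc, weight, normConst, if_pos hα]
        field_simp
      rw [h8]
      calc _ ≤ 1 / Real.pi * (1 - ‖z‖ ^ 2) ^ (α + 1) *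
            (2 * ‖deriv (rep f) z‖ ^ 2 + 2 * C ^ 2 * ‖rep f z‖ ^ 2) := by gcongr
        _ = 2 * (1 / Real.pi * (1 - ‖z‖ ^ 2) ^ (α + 1) * ‖deriv (rep f) z‖ ^ 2) +
            1 / Real.pi * (1 - ‖z‖ ^ 2) ^ (α + 1) * (2 * C ^ 2 * ‖rep f z‖ ^ 2) := by ring
        _ ≤ _ := by gcongr
    refine lt_of_le_of_lt (setLIntegral_mono' measurableSet_ball hbound) ?_
    have hm : AEMeasurable (fun z => ENNReal.ofReal c *
        (ENNReal.ofReal (weight α z) * ‖rep f z‖ₑ ^ 2)) (volume.restrict disk) := by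
      have hm1 : AEMeasurable (fun z => ENNReal.ofReal (weight α z)) (volume.restrict disk) :=
        (((continuousOn_weight α).aestronglyMeasurable
          measurableSet_ball).aemeasurable).ennreal_ofReal
      have hm2 : AEMeasurable (fun z => ‖rep f z‖ₑ ^ 2) (volume.restrict disk) :=
        (((differentiableOn_rep f).continuousOn.aestronglyMeasurable
          measurableSet_ball).enorm).pow_const 2
      exact (hm1.mul hm2).const_mul _
    rw [lintegral_add_right' _ hm, lintegral_const_mul' _ _ (by simp),
      lintegral_const_mul' _ _ ENNReal.ofReal_ne_top]
    exact ENNReal.add_lt_top.2 ⟨ENNReal.mul_lt_top (by simp) hf.2,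
      ENNReal.mul_lt_top ENNReal.ofReal_lt_top hfin⟩

theorem mulOp_mem_range_defectOp_id (hα : -1 < α) {g : ℂ → ℂ} (hg : MemHInftyBall g) {C : ℝ}
    (hg' : ∀ z ∈ disk, ‖deriv g z‖ ≤ C) (x : bergman α) :
    ∃ y, defectOp α memHInftyBall_id y = mulOp α hg (defectOp α memHInftyBall_id x) := by
  rw [← rep_mem_genBergman_iff hα]
  have h1 := (rep_mem_genBergman_iff hα _).2 ⟨x, rfl⟩
  have h2 := mul_rep_mem_genBergman hα hg hg' h1
  exact (genBergman_congr hα (differentiableOn_rep _) h2.1 (rep_mulOp hg _)).2 h2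

theorem norm_defectOp_id_adjoint_mulOp_le (hα : -1 < α) {g : ℂ → ℂ} (hg : MemHInftyBall g) {C : ℝ}
    (hg' : ∀ z ∈ disk, ‖deriv g z‖ ≤ C) :
    ∃ C' : ℝ, 0 ≤ C' ∧ ∀ x, ‖defectOp α memHInftyBall_id
      (ContinuousLinearMap.adjoint (mulOp α hg) x)‖ ≤ C' * ‖defectOp α memHInftyBall_id x‖ :=
  norm_comp_adjoint_le_of_range_invariant (defect_isSelfAdjoint _) (defectOp_id_injective hα)
    (mulOp_mem_range_defectOp_id hα hg hg')

/-! ### Möbius factors -/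

/-- The Möbius transformation of the disk that exchanges `0` and `a`. -/
noncomputable def mobius (a z : ℂ) : ℂ := (a - z) / (1 - conj a * z)

theorem norm_one_sub_sq_sub (a z : ℂ) :
    ‖1 - conj a * z‖ ^ 2 - ‖a - z‖ ^ 2 = (1 - ‖a‖ ^ 2) * (1 - ‖z‖ ^ 2) := by
  simp only [Complex.sq_norm, Complex.normSq_apply, Complex.sub_re, Complex.sub_im, Complex.mul_re,
    Complex.mul_im, Complex.conj_re, Complex.conj_im, Complex.one_re, Complex.one_im]
  ring

theorem one_sub_norm_pos {a : ℂ} (ha : a ∈ disk) : 0 < 1 - ‖a‖ := by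
  have : ‖a‖ < 1 := by simpa using ha
  linarith

theorem one_sub_norm_le_norm_one_sub {a z : ℂ} (hz : z ∈ disk) :
    1 - ‖a‖ ≤ ‖1 - conj a * z‖ := by
  have h1 : ‖z‖ < 1 := by simpa using hz
  have h2 := norm_sub_norm_le (1 : ℂ) (conj a * z)
  rw [norm_one, norm_mul, RCLike.norm_conj] at h2
  nlinarith [norm_nonneg a]

theorem one_sub_conj_mul_ne_zero {a z : ℂ} (ha : a ∈ disk) (hz : z ∈ disk) :
    1 - conj a * z ≠ 0 :=
  norm_pos_iff.1 ((one_sub_norm_pos ha).trans_le (one_sub_norm_le_norm_one_sub hz))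

theorem norm_mobius_le_one {a z : ℂ} (ha : a ∈ disk) (hz : z ∈ disk) : ‖mobius a z‖ ≤ 1 := by
  rw [mobius, norm_div, div_le_one (norm_pos_iff.2 (one_sub_conj_mul_ne_zero ha hz))]
  refine le_of_sq_le_sq ?_ (norm_nonneg _)
  have h1 := norm_one_sub_sq_sub a z
  nlinarith [mul_pos (one_sub_norm_sq_pos ha) (one_sub_norm_sq_pos hz)]

theorem hasDerivAt_one_sub_conj_mul (a z : ℂ) :
    HasDerivAt (fun z => 1 - conj a * z) (-conj a) z := by
  simpa using ((hasDerivAt_id z).const_mul (conj a)).const_sub 1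

theorem hasDerivAt_mobius {a z : ℂ} (ha : a ∈ disk) (hz : z ∈ disk) :
    HasDerivAt (mobius a) ((-1 * (1 - conj a * z) - (a - z) * (-conj a)) / (1 - conj a * z) ^ 2)
      z :=
  ((hasDerivAt_id z).const_sub a).div (hasDerivAt_one_sub_conj_mul a z)
    (one_sub_conj_mul_ne_zero ha hz)

theorem differentiableOn_mobius {a : ℂ} (ha : a ∈ disk) : DifferentiableOn ℂ (mobius a) disk :=
  fun _ hz => (hasDerivAt_mobius ha hz).differentiableAt.differentiableWithinAt

theorem memHInftyBall_mobius {a : ℂ} (ha : a ∈ disk) : MemHInftyBall (mobius a) :=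
  ⟨differentiableOn_mobius ha, fun _ hz => norm_mobius_le_one ha hz⟩

theorem norm_deriv_mobius_le {a : ℂ} (ha : a ∈ disk) :
    ∀ z ∈ disk, ‖deriv (mobius a) z‖ ≤ 4 / (1 - ‖a‖) ^ 2 := by
  intro z hz
  have h1 : ‖z‖ < 1 := by simpa using hz
  have h2 : ‖a‖ < 1 := by simpa using ha
  have h3 := one_sub_norm_pos ha
  have h4 := one_sub_norm_le_norm_one_sub (a := a) hz
  have h5 : ‖a - z‖ ≤ 2 := (norm_sub_le _ _).trans (by linarith)
  have h6 : ‖1 - conj a * z‖ ≤ 2 := by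
    refine (norm_sub_le _ _).trans ?_
    rw [norm_one, norm_mul, RCLike.norm_conj]
    nlinarith [norm_nonneg a, norm_nonneg z]
  rw [(hasDerivAt_mobius ha hz).deriv, norm_div, norm_pow]
  refine div_le_div₀ (by norm_num) ?_ (by positivity) (pow_le_pow_left₀ h3.le h4 2)
  refine (norm_sub_le _ _).trans ?_
  rw [norm_mul, norm_mul, norm_neg, norm_neg, norm_one, RCLike.norm_conj]
  nlinarith [norm_nonneg a, norm_nonneg (a - z)]

/-- The function `1 / (1 - conj a z)`, scaled to the unit ball of `H^∞`. -/
noncomputable def szego (a z : ℂ) : ℂ := ((1 - ‖a‖ : ℝ) : ℂ) / (1 - conj a * z)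

theorem hasDerivAt_szego {a z : ℂ} (ha : a ∈ disk) (hz : z ∈ disk) :
    HasDerivAt (szego a) ((0 * (1 - conj a * z) - ((1 - ‖a‖ : ℝ) : ℂ) * (-conj a)) /
      (1 - conj a * z) ^ 2) z :=
  (hasDerivAt_const z _).div (hasDerivAt_one_sub_conj_mul a z) (one_sub_conj_mul_ne_zero ha hz)

theorem memHInftyBall_szego {a : ℂ} (ha : a ∈ disk) : MemHInftyBall (szego a) := by
  refine ⟨fun z hz => (hasDerivAt_szego ha hz).differentiableAt.differentiableWithinAt,
    fun z hz => ?_⟩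
  rw [szego, norm_div, Complex.norm_real, Real.norm_of_nonneg (one_sub_norm_pos ha).le,
    div_le_one (norm_pos_iff.2 (one_sub_conj_mul_ne_zero ha hz))]
  exact one_sub_norm_le_norm_one_sub hz

theorem norm_deriv_szego_le {a : ℂ} (ha : a ∈ disk) :
    ∀ z ∈ disk, ‖deriv (szego a) z‖ ≤ 1 / (1 - ‖a‖) ^ 2 := by
  intro z hz
  have h2 : ‖a‖ < 1 := by simpa using ha
  have h3 := one_sub_norm_pos ha
  have h4 := one_sub_norm_le_norm_one_sub (a := a) hz
  rw [(hasDerivAt_szego ha hz).deriv, norm_div, norm_pow]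
  refine div_le_div₀ (by norm_num) ?_ (by positivity) (pow_le_pow_left₀ h3.le h4 2)
  rw [zero_mul, zero_sub, norm_neg, norm_mul, norm_neg, RCLike.norm_conj, Complex.norm_real,
    Real.norm_of_nonneg h3.le]
  nlinarith [norm_nonneg a]

/-! ### The defect of a Möbius factor -/

section Hilbert

variable {H : Type*} [NormedAddCommGroup H] [InnerProductSpace ℂ H]

/-- The cross terms cancel, since `⟨y, a v⟩ = a ⟨y, v⟩ = ⟨ā y, v⟩`. This is the vector form of
`norm_one_sub_sq_sub`. -/
theorem norm_sub_smul_sq_sub (a : ℂ) (y v : H) :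
    ‖y - a • v‖ ^ 2 - ‖conj a • y - v‖ ^ 2 = (1 - ‖a‖ ^ 2) * (‖y‖ ^ 2 - ‖v‖ ^ 2) := by
  rw [norm_sub_sq (𝕜 := ℂ), norm_sub_sq (𝕜 := ℂ), inner_smul_right, inner_smul_left, norm_smul,
    norm_smul, RCLike.norm_conj, Complex.conj_conj]
  ring

theorem adjoint_mul_apply [CompleteSpace H] (A B : H →L[ℂ] H) (x : H) :
    ContinuousLinearMap.adjoint (A * B) x =
      ContinuousLinearMap.adjoint B (ContinuousLinearMap.adjoint A x) :=
  DFunLike.congr_fun (star_mul A B) x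

theorem adjoint_smul_one_apply [CompleteSpace H] (c : ℂ) (x : H) :
    ContinuousLinearMap.adjoint (c • (1 : H →L[ℂ] H)) x = conj c • x := by
  rw [map_smulₛₗ, smul_apply]
  exact congrArg _ (DFunLike.congr_fun (star_one (H →L[ℂ] H)) x)

/-- `Z`, `R`, `T` stand for multiplication by `z`, by `s/(1-āz)` and by the Möbius factor. With `y =
R* x` and `v = Z* y`, the adjoint relations read `s x = y - a v` and `s T* x = ā y - v`, and
`norm_sub_smul_sq_sub` applies. -/
theorem norm_sq_sub_of_mobius_relation [CompleteSpace H] {Z R T : H →L[ℂ] H} {a : ℂ} {s : ℝ}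
    (hR : R * (1 - conj a • Z) = (s : ℂ) • (1 : H →L[ℂ] H))
    (hT : (1 - conj a • Z) * T = a • (1 : H →L[ℂ] H) - Z) (x : H) :
    s ^ 2 * (‖x‖ ^ 2 - ‖ContinuousLinearMap.adjoint T x‖ ^ 2) =
      (1 - ‖a‖ ^ 2) * (‖ContinuousLinearMap.adjoint R x‖ ^ 2 -
        ‖ContinuousLinearMap.adjoint Z (ContinuousLinearMap.adjoint R x)‖ ^ 2) ∧
    (s : ℂ) • x = ContinuousLinearMap.adjoint R x -
      a • ContinuousLinearMap.adjoint Z (ContinuousLinearMap.adjoint R x) := by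
  have h1 := DFunLike.congr_fun (congrArg star hR) x
  have h2 := DFunLike.congr_fun (congrArg star hT) (ContinuousLinearMap.adjoint R x)
  simp only [star_mul, star_sub, star_smul, star_one, ContinuousLinearMap.star_eq_adjoint,
    mul_apply_eq_comp, sub_apply, smul_apply, one_apply_eq_self, RCLike.star_def, Complex.conj_conj, Complex.conj_ofReal]
    at h1 h2
  refine ⟨?_, h1.symm⟩
  rw [h1, map_smul] at h2
  rw [← norm_sub_smul_sq_sub, h1, ← h2, norm_smul, norm_smul, Complex.norm_real, Real.norm_eq_abs,
    mul_pow, mul_pow, sq_abs]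
  ring

/-- The exact relation is `s ‖D x‖ = √(1-|a|²) ‖Λ R* x‖`. The bound for `Λ R*` gives the upper
estimate; for the lower one, `s x = y - a Z* y` with `y = R* x` gives `s ‖Λ x‖ ≤ (1 + |a| C₁) ‖Λ
y‖`. -/
theorem norm_bounds_of_mobius_relation [CompleteSpace H] {Z R T Λ D : H →L[ℂ] H} {a : ℂ}
    {s C₁ C₂ : ℝ} (hs : 0 < s) (ha : 0 < 1 - ‖a‖ ^ 2)
    (hR : R * (1 - conj a • Z) = (s : ℂ) • (1 : H →L[ℂ] H))
    (hT : (1 - conj a • Z) * T = a • (1 : H →L[ℂ] H) - Z)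
    (hΛ : ∀ x, ‖Λ x‖ ^ 2 = ‖x‖ ^ 2 - ‖ContinuousLinearMap.adjoint Z x‖ ^ 2)
    (hD : ∀ x, ‖D x‖ ^ 2 = ‖x‖ ^ 2 - ‖ContinuousLinearMap.adjoint T x‖ ^ 2)
    (hC₁ : 0 ≤ C₁) (h₁ : ∀ x, ‖Λ (ContinuousLinearMap.adjoint Z x)‖ ≤ C₁ * ‖Λ x‖)
    (hC₂ : 0 ≤ C₂) (h₂ : ∀ x, ‖Λ (ContinuousLinearMap.adjoint R x)‖ ≤ C₂ * ‖Λ x‖) :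
    ∃ c C : ℝ, 0 ≤ c ∧ 0 ≤ C ∧ ∀ x, ‖Λ x‖ ≤ c * ‖D x‖ ∧ ‖D x‖ ≤ C * ‖Λ x‖ := by
  set k := √(1 - ‖a‖ ^ 2) with hk'
  have hk0 : 0 < k := Real.sqrt_pos.2 ha
  have key : ∀ x, s * ‖D x‖ = k * ‖Λ (ContinuousLinearMap.adjoint R x)‖ := by
    intro x
    have h3 := (norm_sq_sub_of_mobius_relation hR hT x).1
    rw [← hD, ← hΛ] at h3
    refine (pow_left_inj₀ (by positivity) (by positivity) two_ne_zero).1 ?_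
    rw [mul_pow, mul_pow, Real.sq_sqrt ha.le]
    exact h3
  refine ⟨(1 + ‖a‖ * C₁) / k, k * C₂ / s, by positivity, by positivity, fun x => ⟨?_, ?_⟩⟩
  · set y := ContinuousLinearMap.adjoint R x with hy
    have h4 : (s : ℂ) • x = y - a • ContinuousLinearMap.adjoint Z y :=
      (norm_sq_sub_of_mobius_relation hR hT x).2
    have h5 : s * ‖Λ x‖ ≤ (1 + ‖a‖ * C₁) * ‖Λ y‖ := by
      have h6 : ‖Λ ((s : ℂ) • x)‖ = s * ‖Λ x‖ := by
        rw [map_smul, norm_smul, Complex.norm_real, Real.norm_of_nonneg hs.le]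
      rw [← h6, h4, map_sub, map_smul, add_mul, one_mul]
      refine (norm_sub_le _ _).trans (add_le_add_right ?_ _)
      rw [norm_smul, mul_assoc]
      exact mul_le_mul_of_nonneg_left (h₁ y) (norm_nonneg _)
    have h8 : ‖Λ y‖ = s * ‖D x‖ / k := by
      rw [key x, ← hy]
      field_simp
    rw [h8] at h5
    refine le_of_mul_le_mul_left (h5.trans (le_of_eq ?_)) hs
    ring
  · rw [div_mul_eq_mul_div, le_div_iff₀ hs, mul_comm, key x, mul_assoc]
    exact mul_le_mul_of_nonneg_left (h₂ x) hk0.le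

end Hilbert

theorem mulOp_szego_mul {a : ℂ} (ha : a ∈ disk) :
    mulOp α (memHInftyBall_szego ha) * (1 - conj a • mulOp α memHInftyBall_id) =
      ((1 - ‖a‖ : ℝ) : ℂ) • (1 : bergman α →L[ℂ] bergman α) := by
  refine ContinuousLinearMap.ext fun f => bergman_ext fun z hz => ?_
  have h1 := one_sub_conj_mul_ne_zero ha hz
  refine (rep_mulOp (memHInftyBall_szego ha) _ z hz).trans ?_
  refine Eq.trans ?_ (rep_smul _ f z hz).symm
  have h2 : rep ((1 - conj a • mulOp α memHInftyBall_id) f) z =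
      rep f z - conj a * (z * rep f z) :=
    (rep_sub f _ z hz).trans (by
      exact congrArg _ ((rep_smul _ _ z hz).trans
        (congrArg _ (rep_mulOp memHInftyBall_id f z hz))))
  refine (congrArg _ h2).trans ?_
  rw [szego]
  field_simp

theorem mul_mulOp_mobius {a : ℂ} (ha : a ∈ disk) :
    (1 - conj a • mulOp α memHInftyBall_id) * mulOp α (memHInftyBall_mobius ha) =
      a • (1 : bergman α →L[ℂ] bergman α) - mulOp α memHInftyBall_id := by
  refine ContinuousLinearMap.ext fun f => bergman_ext fun z hz => ?_
  have h1 := one_sub_conj_mul_ne_zero ha hz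
  set g := mulOp α (memHInftyBall_mobius ha) f with hg
  have h2 : rep ((1 - conj a • mulOp α memHInftyBall_id) g) z =
      rep g z - conj a * (z * rep g z) :=
    (rep_sub g _ z hz).trans (by
      exact congrArg _ ((rep_smul _ _ z hz).trans
        (congrArg _ (rep_mulOp memHInftyBall_id g z hz))))
  have h3 : rep ((a • (1 : bergman α →L[ℂ] bergman α) - mulOp α memHInftyBall_id) f) z =
      a * rep f z - z * rep f z :=
    (rep_sub (a • f) _ z hz).trans
      (congrArg₂ _ (rep_smul _ _ z hz) (rep_mulOp memHInftyBall_id f z hz))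
  refine h2.trans (Eq.trans ?_ h3.symm)
  rw [hg, rep_mulOp _ _ z hz, mobius]
  have h4 : 1 - z * conj a ≠ 0 := by rwa [mul_comm]
  field_simp

theorem norm_defectOp_sq {φ : ℂ → ℂ} (hφ : MemHInftyBall φ) (x : bergman α) :
    ‖defectOp α hφ x‖ ^ 2 = ‖x‖ ^ 2 - ‖ContinuousLinearMap.adjoint (mulOp α hφ) x‖ ^ 2 :=
  norm_defect_sq (norm_mulOp_le hφ) x

theorem norm_defectOp_mobius_bounds (hα : -1 < α) {a : ℂ} (ha : a ∈ disk) :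
    ∃ c C : ℝ, 0 ≤ c ∧ 0 ≤ C ∧ ∀ x : bergman α,
      ‖defectOp α memHInftyBall_id x‖ ≤ c * ‖defectOp α (memHInftyBall_mobius ha) x‖ ∧
      ‖defectOp α (memHInftyBall_mobius ha) x‖ ≤ C * ‖defectOp α memHInftyBall_id x‖ := by
  obtain ⟨C₁, hC₁, h₁⟩ := norm_defectOp_id_adjoint_mulOp_le hα memHInftyBall_id (C := 1)
    fun z _ => by simp
  obtain ⟨C₂, hC₂, h₂⟩ := norm_defectOp_id_adjoint_mulOp_le hα (memHInftyBall_szego ha)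
    (norm_deriv_szego_le ha)
  exact norm_bounds_of_mobius_relation (one_sub_norm_pos ha) (one_sub_norm_sq_pos ha)
    (mulOp_szego_mul ha) (mul_mulOp_mobius ha) (norm_defectOp_sq memHInftyBall_id)
    (norm_defectOp_sq (memHInftyBall_mobius ha)) hC₁ h₁ hC₂ h₂

/-! ### Finite Blaschke products -/

theorem mulOp_eq_mul {φ ψ χ : ℂ → ℂ} (hφ : MemHInftyBall φ) (hψ : MemHInftyBall ψ)
    (hχ : MemHInftyBall χ) (h : ∀ z ∈ disk, φ z = ψ z * χ z) :
    mulOp α hφ = mulOp α hψ * mulOp α hχ := by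
  refine ContinuousLinearMap.ext fun f => bergman_ext fun z hz => ?_
  refine (rep_mulOp hφ f z hz).trans ?_
  refine Eq.trans ?_ (rep_mulOp hψ _ z hz).symm
  refine Eq.trans ?_ (congrArg _ (rep_mulOp hχ f z hz).symm)
  rw [h z hz, mul_assoc]

theorem defectOp_congr {φ ψ : ℂ → ℂ} (hφ : MemHInftyBall φ) (hψ : MemHInftyBall ψ)
    (h : ∀ z ∈ disk, φ z = ψ z) : defectOp α hφ = defectOp α hψ := by
  have h1 : mulOp α hφ = mulOp α hψ := by
    refine ContinuousLinearMap.ext fun f => bergman_ext fun z hz => ?_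
    refine (rep_mulOp hφ f z hz).trans ?_
    rw [h z hz]
    exact (rep_mulOp hψ f z hz).symm
  rw [defectOp, defectOp, h1]

/-- The difference `‖x‖² - ‖T_χ* T_ψ* x‖²` telescopes through `‖T_ψ* x‖²`. In particular the defect
of a product dominates that of each factor. -/
theorem norm_defectOp_mul_sq {φ ψ χ : ℂ → ℂ} (hφ : MemHInftyBall φ) (hψ : MemHInftyBall ψ)
    (hχ : MemHInftyBall χ) (h : ∀ z ∈ disk, φ z = ψ z * χ z) (x : bergman α) :
    ‖defectOp α hφ x‖ ^ 2 = ‖defectOp α hψ x‖ ^ 2 +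
      ‖defectOp α hχ (ContinuousLinearMap.adjoint (mulOp α hψ) x)‖ ^ 2 := by
  have h1 : ContinuousLinearMap.adjoint (mulOp α hφ) x =
      ContinuousLinearMap.adjoint (mulOp α hχ) (ContinuousLinearMap.adjoint (mulOp α hψ) x) := by
    rw [mulOp_eq_mul (α := α) hφ hψ hχ h]
    exact adjoint_mul_apply _ _ _
  rw [norm_defectOp_sq, norm_defectOp_sq, norm_defectOp_sq, h1]
  ring

theorem defectOp_eq_zero_of_unimodular {φ : ℂ → ℂ} (hφ : MemHInftyBall φ) {c : ℂ} (hc : ‖c‖ = 1)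
    (h : ∀ z ∈ disk, φ z = c) (x : bergman α) : defectOp α hφ x = 0 := by
  have h1 : mulOp α hφ = c • (1 : bergman α →L[ℂ] bergman α) := by
    refine ContinuousLinearMap.ext fun f => bergman_ext fun z hz => ?_
    refine (rep_mulOp hφ f z hz).trans (Eq.trans ?_ (rep_smul c f z hz).symm)
    rw [h z hz]
  have h2 : ContinuousLinearMap.adjoint (mulOp α hφ) x = conj c • x := by
    rw [h1]
    exact adjoint_smul_one_apply c x
  have h4 := norm_defectOp_sq hφ x
  rw [h2, norm_smul, RCLike.norm_conj, hc, one_mul, sub_self] at h4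
  simpa using h4

theorem memHInftyBall_blaschke {n : ℕ} {a : Fin n → ℂ} {c : ℂ} (ha : ∀ i, a i ∈ disk)
    (hc : ‖c‖ = 1) : MemHInftyBall fun z => c * ∏ i, mobius (a i) z := by
  refine ⟨DifferentiableOn.const_mul (DifferentiableOn.fun_finsetProd fun i _ =>
    differentiableOn_mobius (ha i)) c, fun z hz => ?_⟩
  rw [norm_mul, hc, one_mul, norm_prod]
  exact Finset.prod_le_one (fun _ _ => norm_nonneg _) fun i _ => norm_mobius_le_one (ha i) hz

theorem norm_defectOp_blaschke_le (hα : -1 < α) {n : ℕ} : ∀ {a : Fin n → ℂ} {c : ℂ}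
    (ha : ∀ i, a i ∈ disk) (hc : ‖c‖ = 1), ∃ C : ℝ, 0 ≤ C ∧ ∀ x : bergman α,
      ‖defectOp α (memHInftyBall_blaschke ha hc) x‖ ≤ C * ‖defectOp α memHInftyBall_id x‖ := by
  induction n with
  | zero =>
    intro a c ha hc
    refine ⟨0, le_rfl, fun x => ?_⟩
    rw [defectOp_eq_zero_of_unimodular _ hc (by simp), norm_zero, zero_mul]
  | succ n ih =>
    intro a c ha hc
    obtain ⟨C₁, hC₁, h₁⟩ := ih (a := fun i => a i.succ) (fun i => ha i.succ) hc
    obtain ⟨_, C₂, -, hC₂, h₂⟩ := norm_defectOp_mobius_bounds hα (ha 0)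
    obtain ⟨C₃, hC₃, h₃⟩ := norm_defectOp_id_adjoint_mulOp_le hα (memHInftyBall_mobius (ha 0))
      (norm_deriv_mobius_le (ha 0))
    -- The two squared contributions `(C₂ t)²` and `(C₁ C₃ t)²` are bounded by the square of the
    -- sum, whose cross term is nonnegative.
    refine ⟨C₂ + C₁ * C₃, by positivity, fun x => le_of_sq_le_sq ?_ (by positivity)⟩
    rw [norm_defectOp_mul_sq (memHInftyBall_blaschke ha hc) (memHInftyBall_mobius (ha 0))
      (memHInftyBall_blaschke (fun i => ha i.succ) hc) fun z _ => by
        rw [Fin.prod_univ_succ, mul_left_comm]]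
    set t := ‖defectOp α memHInftyBall_id x‖ with ht
    have ht0 : 0 ≤ t := norm_nonneg _
    have h4 := pow_le_pow_left₀ (norm_nonneg _) ((h₂ x).2) 2
    have h5 := pow_le_pow_left₀ (norm_nonneg _) ((h₁ (ContinuousLinearMap.adjoint
      (mulOp α (memHInftyBall_mobius (ha 0))) x)).trans
      (mul_le_mul_of_nonneg_left (h₃ x) hC₁)) 2
    have h6 : 0 ≤ C₂ * t * (C₁ * (C₃ * t)) := by positivity
    refine (add_le_add h4 h5).trans ?_
    linear_combination 2 * h6

theorem subBergman_eq_genBergman_of_blaschke (hα : -1 < α) {φ : ℂ → ℂ} (hφ : MemHInftyBall φ)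
    (hconst : ¬ ∃ c : ℂ, ‖c‖ = 1 ∧ ∀ z ∈ disk, φ z = c) (hB : IsFiniteBlaschkeProduct φ) :
    subBergman α hφ = genBergman (α - 1) := by
  obtain ⟨n, a, c, ha, hc, hφB⟩ := hB
  cases n with
  -- An empty product is a unimodular constant, for which the defect operator is zero; the
  -- hypothesis excludes it.
  | zero => exact absurd ⟨c, hc, fun z hz => by simpa using hφB z hz⟩ hconst
  | succ n =>
    obtain ⟨C₁, hC₁, h₁⟩ := norm_defectOp_blaschke_le hα ha hc
    obtain ⟨C₂, _, hC₂, -, h₂⟩ := norm_defectOp_mobius_bounds hα (ha 0)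
    have hup : ∀ x : bergman α, ‖defectOp α hφ x‖ ≤ C₁ * ‖defectOp α memHInftyBall_id x‖ := by
      intro x
      rw [defectOp_congr hφ (memHInftyBall_blaschke ha hc) hφB]
      exact h₁ x
    -- A single Möbius factor already gives the lower bound, because the remaining factors only add
    -- a nonnegative term.
    have hlow : ∀ x : bergman α, ‖defectOp α memHInftyBall_id x‖ ≤ C₂ * ‖defectOp α hφ x‖ := by
      intro x
      refine (h₂ x).1.trans (mul_le_mul_of_nonneg_left ?_ hC₂)
      refine le_of_sq_le_sq ?_ (norm_nonneg _)
      rw [norm_defectOp_mul_sq hφ (memHInftyBall_mobius (ha 0))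
        (memHInftyBall_blaschke (fun i => ha i.succ) hc) fun z hz => by
          rw [hφB z hz, Fin.prod_univ_succ, mul_left_comm]; rfl]
      exact le_add_of_nonneg_right (by positivity)
    rw [← subBergman_id hα]
    refine Subset.antisymm ((subBergman_subset_iff _ _).2 ?_) ((subBergman_subset_iff _ _).2 ?_)
    · exact range_le_range_of_norm_le (defect_isSelfAdjoint _) (defect_isSelfAdjoint _) hup
    · exact range_le_range_of_norm_le (defect_isSelfAdjoint _) (defect_isSelfAdjoint _) hlow

theorem isCompactOperator_defectOp_of_subset (hα : -1 < α) {φ : ℂ → ℂ} (hφ : MemHInftyBall φ)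
    (h : subBergman α hφ ⊆ genBergman (α - 1)) : IsCompactOperator (defectOp α hφ) := by
  rw [← subBergman_id hα, subBergman_subset_iff] at h
  obtain ⟨X, hX⟩ := exists_factorization_of_range_le (defectOp_id_injective hα) h
  rw [hX]
  exact (isCompactOperator_defectOp_id hα).comp_clm X

/-! ### Compactness of the defect operator and boundary values -/

section Hilbert

variable {H : Type*} [NormedAddCommGroup H] [InnerProductSpace ℂ H]

/-- For a bounded family, weak convergence to `0` need only be tested on a set with dense span. -/
theorem tendsto_inner_of_hilbertBasis (b : HilbertBasis ℕ ℂ H) {ι : Type*} {l : Filter ι}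
    {k : ι → H} (hk : ∀ i, ‖k i‖ ≤ 1) (h : ∀ n, Tendsto (fun i => inner ℂ (k i) (b n)) l (𝓝 0))
    (x : H) : Tendsto (fun i => inner ℂ (k i) x) l (𝓝 0) := by
  have hspan : ∀ p ∈ Submodule.span ℂ (range b), Tendsto (fun i => inner ℂ (k i) p) l (𝓝 0) := by
    intro p hp
    induction hp using Submodule.span_induction with
    | mem y hy =>
      obtain ⟨n, rfl⟩ := hy
      exact h n
    | zero => simpa using tendsto_const_nhds
    | add y z _ _ hy hz => simpa [inner_add_right] using hy.add hz
    | smul c y _ hy => simpa [inner_smul_right] using hy.const_mul c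
  rw [Metric.tendsto_nhds]
  intro ε hε
  have hx : x ∈ closure (Submodule.span ℂ (range b) : Set H) := by
    rw [← Submodule.topologicalClosure_coe, b.dense_span]
    trivial
  obtain ⟨p, hp, hxp⟩ := Metric.mem_closure_iff.1 hx (ε / 2) (half_pos hε)
  filter_upwards [Metric.tendsto_nhds.1 (hspan p hp) (ε / 2) (half_pos hε)] with i hi
  rw [dist_zero_right] at hi ⊢
  rw [dist_eq_norm] at hxp
  have h1 : inner ℂ (k i) x = inner ℂ (k i) (x - p) + inner ℂ (k i) p := by
    rw [← inner_add_right, sub_add_cancel]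
  have h2 : ‖inner ℂ (k i) (x - p)‖ ≤ ‖x - p‖ :=
    (norm_inner_le_norm _ _).trans (mul_le_of_le_one_left (norm_nonneg _) (hk i))
  rw [h1]
  linarith [norm_add_le (inner ℂ (k i) (x - p)) (inner ℂ (k i) p)]

/-- Compact operators map bounded weakly null families to norm null families. -/
theorem tendsto_norm_of_isCompactOperator [CompleteSpace H] {D : H →L[ℂ] H}
    (hD : IsCompactOperator D) {ι : Type*} {l : Filter ι} {k : ι → H} (hk : ∀ i, ‖k i‖ ≤ 1)
    (h : ∀ x, Tendsto (fun i => inner ℂ (k i) x) l (𝓝 0)) :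
    Tendsto (fun i => D (k i)) l (𝓝 0) := by
  have hK := hD.isCompact_closure_image_closedBall (f := D.toLinearMap) 1
  -- Ultrafilters take the place of subsequences: along each one compactness provides a limit `y`,
  -- and weak nullity forces `y = 0`.
  rw [tendsto_iff_ultrafilter]
  intro u hu
  obtain ⟨y, -, hy⟩ := hK.ultrafilter_le_nhds (u.map fun i => D (k i)) (by
    rw [le_principal_iff, Ultrafilter.mem_coe, Ultrafilter.mem_map]
    exact Filter.univ_mem' fun i => subset_closure ⟨k i, by simpa using hk i, rfl⟩)
  have hy' : Tendsto (fun i => D (k i)) u (𝓝 y) := hy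
  have hzero : y = 0 := by
    refine ext_inner_right ℂ fun x => ?_
    have h1 : Tendsto (fun i => inner ℂ (D (k i)) x) u (𝓝 (inner ℂ y x)) :=
      hy'.inner tendsto_const_nhds
    simp only [← ContinuousLinearMap.adjoint_inner_right] at h1
    rw [inner_zero_left]
    exact tendsto_nhds_unique h1 ((h _).mono_left hu)
  rwa [hzero] at hy'

theorem norm_sq_inv_norm_smul {D : H →L[ℂ] H} {K : H} {t : ℝ} (hK : 0 < ‖K‖)
    (h : ‖D K‖ ^ 2 = t * ‖K‖ ^ 2) : ‖D (((‖K‖⁻¹ : ℝ) : ℂ) • K)‖ ^ 2 = t := by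
  rw [map_smul, norm_smul, mul_pow, h, Complex.norm_real, norm_inv, norm_norm]
  field_simp

theorem norm_inv_norm_smul_le_one (K : H) : ‖((‖K‖⁻¹ : ℝ) : ℂ) • K‖ ≤ 1 := by
  rw [norm_smul, Complex.norm_real, norm_inv, norm_norm]
  exact inv_mul_le_one

theorem norm_inner_inv_norm_smul (K x : H) :
    ‖inner ℂ (((‖K‖⁻¹ : ℝ) : ℂ) • K) x‖ = ‖K‖⁻¹ * ‖inner ℂ K x‖ := by
  rw [inner_smul_left, norm_mul, RCLike.norm_conj, Complex.norm_real, norm_inv, norm_norm]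

end Hilbert

/-- The filter of points of the disk approaching the unit circle. -/
noncomputable def towardCircle : Filter ℂ := comap norm (𝓝[<] (1 : ℝ))

theorem eventually_towardCircle_mem_disk : ∀ᶠ z in towardCircle, z ∈ disk := by
  have h : ∀ᶠ r in 𝓝[<] (1 : ℝ), r < 1 := eventually_mem_nhdsWithin
  filter_upwards [h.comap norm] with z hz
  simpa using hz

theorem tendsto_norm_towardCircle : Tendsto norm towardCircle (𝓝 (1 : ℝ)) :=
  tendsto_comap.mono_right nhdsWithin_le_nhds

theorem tendsto_norm_of_isCompactOperator_defectOp (hα : -1 < α) {φ : ℂ → ℂ}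
    (hφ : MemHInftyBall φ) (hD : IsCompactOperator (defectOp α hφ)) :
    Tendsto (fun z => ‖φ z‖) towardCircle (𝓝 1) := by
  -- Off the disk the kernel is given the junk value `0`, so that the family is indexed by all of
  -- `ℂ`.
  have hex : ∀ w : ℂ, ∃ K : bergman α, w ∈ disk → ∀ f, inner ℂ K f = rep f w := by
    intro w
    by_cases hw : w ∈ disk
    · obtain ⟨K, hK⟩ := exists_kernel (α := α) w hw
      exact ⟨K, fun _ => hK⟩
    · exact ⟨0, fun h => absurd h hw⟩
  choose K hK using hex
  have hKpos : ∀ w ∈ disk, 0 < ‖K w‖ := by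
    intro w hw
    have h1 := norm_kernel_sq_ge hα hw (hK w hw)
    have h2 := inv_pos.2 (one_sub_norm_sq_pos hw)
    exact lt_of_pow_lt_pow_left₀ 2 (norm_nonneg _) (by
      rw [zero_pow two_ne_zero]
      exact h2.trans_le h1)
  have hKinv : Tendsto (fun w => ‖K w‖⁻¹) towardCircle (𝓝 0) := by
    have h1 : Tendsto (fun w : ℂ => √(1 - ‖w‖ ^ 2)) towardCircle (𝓝 0) := by
      have h2 : Tendsto (fun r : ℝ => √(1 - r ^ 2)) (𝓝 1) (𝓝 0) := by
        have : Continuous fun r : ℝ => √(1 - r ^ 2) := by fun_prop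
        simpa using this.tendsto 1
      exact h2.comp tendsto_norm_towardCircle
    refine squeeze_zero' (Eventually.of_forall fun w => inv_nonneg.2 (norm_nonneg _)) ?_ h1
    filter_upwards [eventually_towardCircle_mem_disk] with w hw
    refine Real.le_sqrt_of_sq_le ?_
    rw [inv_pow]
    exact inv_le_of_inv_le₀ (one_sub_norm_sq_pos hw) (norm_kernel_sq_ge hα hw (hK w hw))
  -- On a normalized monomial the inner product is its value at `w` divided by `‖K w‖`; the monomial
  -- is bounded on the disk and `‖K w‖` tends to infinity.
  have hweak : ∀ x : bergman α, Tendsto (fun w => inner ℂ (((‖K w‖⁻¹ : ℝ) : ℂ) • K w) x)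
      towardCircle (𝓝 0) := by
    refine tendsto_inner_of_hilbertBasis (monomialBasis hα)
      (fun w => norm_inv_norm_smul_le_one (K w)) fun n => ?_
    rw [tendsto_zero_iff_norm_tendsto_zero]
    have h1 := hKinv.mul_const (√(moment α n))⁻¹
    rw [zero_mul] at h1
    refine squeeze_zero' (Eventually.of_forall fun w => norm_nonneg _) ?_ h1
    filter_upwards [eventually_towardCircle_mem_disk] with w hw
    refine (norm_inner_inv_norm_smul (K w) (monomialBasis hα n)).le.trans
      (mul_le_mul_of_nonneg_left ?_ (inv_nonneg.2 (norm_nonneg _)))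
    rw [hK w hw, coe_monomialBasis, rep_monomial hα n w hw, norm_mul, Complex.norm_real,
      norm_pow, Real.norm_of_nonneg (inv_nonneg.2 (Real.sqrt_nonneg _))]
    exact mul_le_of_le_one_right (inv_nonneg.2 (Real.sqrt_nonneg _))
      (pow_le_one₀ (norm_nonneg _) (mem_ball_zero_iff.1 hw).le)
  have hlim := tendsto_norm_of_isCompactOperator hD
    (fun w => norm_inv_norm_smul_le_one (K w)) hweak
  have h1 : Tendsto (fun w => 1 - ‖φ w‖ ^ 2) towardCircle (𝓝 0) := by
    have h2 := (tendsto_norm_zero.comp hlim).pow 2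
    rw [zero_pow two_ne_zero] at h2
    refine h2.congr' ?_
    filter_upwards [eventually_towardCircle_mem_disk] with w hw
    exact norm_sq_inv_norm_smul (hKpos w hw) (norm_defectOp_kernel_sq hφ hw (hK w hw))
  have h3 : Tendsto (fun w => √(1 - (1 - ‖φ w‖ ^ 2))) towardCircle (𝓝 √(1 - 0)) :=
    (Real.continuous_sqrt.tendsto _).comp (tendsto_const_nhds.sub h1)
  simpa using h3

/-! ### Characterization of finite Blaschke products by their boundary behaviour -/

/-- In `1 - |mobius a z|² = (1-|a|²)(1-|z|²)/|1-āz|²` the denominator stays above `(1-|a|)²`. -/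
theorem tendsto_norm_mobius {a : ℂ} (ha : a ∈ disk) :
    Tendsto (fun z => ‖mobius a z‖) towardCircle (𝓝 1) := by
  have hs := one_sub_norm_pos ha
  have h1 : Tendsto (fun z => 1 - ‖mobius a z‖ ^ 2) towardCircle (𝓝 0) := by
    have h2 : Tendsto (fun z : ℂ => (1 - ‖a‖ ^ 2) * (1 - ‖z‖ ^ 2) / (1 - ‖a‖) ^ 2) towardCircle
        (𝓝 0) := by
      have h3 : Tendsto (fun r : ℝ => (1 - ‖a‖ ^ 2) * (1 - r ^ 2) / (1 - ‖a‖) ^ 2) (𝓝 1)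
          (𝓝 0) := by
        have : Continuous fun r : ℝ => (1 - ‖a‖ ^ 2) * (1 - r ^ 2) / (1 - ‖a‖) ^ 2 := by fun_prop
        simpa using this.tendsto 1
      exact h3.comp tendsto_norm_towardCircle
    refine squeeze_zero' ?_ ?_ h2
    · filter_upwards [eventually_towardCircle_mem_disk] with z hz
      have := norm_mobius_le_one ha hz
      nlinarith [norm_nonneg (mobius a z)]
    · filter_upwards [eventually_towardCircle_mem_disk] with z hz
      have h3 := norm_pos_iff.2 (one_sub_conj_mul_ne_zero ha hz)
      have h4 : 1 - ‖mobius a z‖ ^ 2 =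
          (1 - ‖a‖ ^ 2) * (1 - ‖z‖ ^ 2) / ‖1 - conj a * z‖ ^ 2 := by
        rw [← norm_one_sub_sq_sub, mobius, norm_div, sub_div, div_self (by positivity), div_pow]
      rw [h4]
      have h5 := one_sub_norm_sq_pos ha
      have h6 := one_sub_norm_sq_pos hz
      have h7 := one_sub_norm_le_norm_one_sub (a := a) hz
      gcongr
  have h3 : Tendsto (fun w => √(1 - (1 - ‖mobius a w‖ ^ 2))) towardCircle (𝓝 √(1 - 0)) :=
    (Real.continuous_sqrt.tendsto _).comp (tendsto_const_nhds.sub h1)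
  simpa using h3

/-- The filter controls whole circles of radius close to `1`, so the maximum principle applies on a
disk of such a radius containing `z`. -/
theorem norm_le_one_of_tendsto_towardCircle {f : ℂ → ℂ} (hf : DifferentiableOn ℂ f disk)
    (h : Tendsto (fun z => ‖f z‖) towardCircle (𝓝 1)) : ∀ z ∈ disk, ‖f z‖ ≤ 1 := by
  intro z hz
  refine le_of_forall_pos_le_add fun ε hε => ?_
  have h1 : ∀ᶠ w in towardCircle, ‖f w‖ < 1 + ε := h.eventually_lt_const (by linarith)
  rw [towardCircle, eventually_comap] at h1
  have hz1 : ‖z‖ < 1 := by simpa using hz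
  have h2 : ∀ᶠ r in 𝓝[<] (1 : ℝ), r ∈ Ioo ‖z‖ 1 := Ioo_mem_nhdsLT hz1
  obtain ⟨r, hr1, hr⟩ := (h1.and h2).exists
  have hr0 : 0 < r := (norm_nonneg z).trans_lt hr.1
  refine Complex.norm_le_of_forall_mem_frontier_norm_le (U := Metric.ball 0 r)
    Metric.isBounded_ball ?_ ?_ (subset_closure (by simpa using hr.1))
  · exact (hf.mono (Metric.closedBall_subset_ball hr.2)).diffContOnCl_ball subset_rfl
  · intro w hw
    rw [frontier_ball _ hr0.ne', mem_sphere_zero_iff_norm] at hw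
    exact (hr1 w hw).le

/-- Both `f` and `1/f` are bounded by `1`, so `|f| = 1`; a function whose modulus has an interior
maximum is constant. -/
theorem exists_unimodular_const_of_ne_zero {f : ℂ → ℂ} (hf : DifferentiableOn ℂ f disk)
    (h : Tendsto (fun z => ‖f z‖) towardCircle (𝓝 1)) (h0 : ∀ z ∈ disk, f z ≠ 0) :
    ∃ c : ℂ, ‖c‖ = 1 ∧ ∀ z ∈ disk, f z = c := by
  have h1 := norm_le_one_of_tendsto_towardCircle hf h
  have h2 := norm_le_one_of_tendsto_towardCircle (f := fun z => (f z)⁻¹) (hf.fun_inv h0)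
    (by simpa using h.inv₀ one_ne_zero)
  have h3 : ∀ z ∈ disk, ‖f z‖ = 1 := by
    intro z hz
    refine le_antisymm (h1 z hz) ?_
    have h4 := h2 z hz
    rw [norm_inv] at h4
    exact (inv_le_one₀ (norm_pos_iff.2 (h0 z hz))).1 h4
  have hz0 : (0 : ℂ) ∈ disk := by simp
  refine ⟨f 0, h3 0 hz0, fun z hz => ?_⟩
  exact Complex.eqOn_of_isPreconnected_of_isMaxOn_norm (convex_ball (0 : ℂ) 1).isPreconnected
    Metric.isOpen_ball hf hz0 (fun w hw => by simp [h3 w hw, h3 0 hz0]) hz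

theorem exists_eq_mobius_pow_mul {f : ℂ → ℂ} (hf : DifferentiableOn ℂ f disk) {a : ℂ}
    (ha : a ∈ disk) (hne : ¬ ∀ᶠ z in 𝓝 a, f z = 0) :
    ∃ (m : ℕ) (g : ℂ → ℂ), DifferentiableOn ℂ g disk ∧ g a ≠ 0 ∧
      ∀ z ∈ disk, f z = mobius a z ^ m * g z := by
  obtain ⟨m, g, hg, hga, hfg⟩ := (hf.analyticAt
    (Metric.isOpen_ball.mem_nhds ha)).exists_eventuallyEq_pow_smul_nonzero_iff.2 hne
  classical
  have hga' : (fun z => g z * (-(1 - conj a * z)) ^ m) a ≠ 0 :=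
    mul_ne_zero hga (pow_ne_zero _ (neg_ne_zero.2 (one_sub_conj_mul_ne_zero ha ha)))
  have hmob : ∀ z ∈ disk, z ≠ a → mobius a z ≠ 0 := fun z hz hza =>
    div_ne_zero (sub_ne_zero.2 hza.symm) (one_sub_conj_mul_ne_zero ha hz)
  -- Near `a` the function is `(z - a)^m` times the local factor, and `z - a = -(1-āz) · mobius a
  -- z`. Hence the quotient by `mobius a z ^ m` continues analytically through `a` with the value
  -- prescribed there.
  refine ⟨m, fun z => if z = a then g z * (-(1 - conj a * z)) ^ m else f z / mobius a z ^ m,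
    fun z hz => ?_, by simpa using hga', fun z hz => ?_⟩
  · by_cases hza : z = a
    · subst hza
      have heq : (fun w => if w = z then g w * (-(1 - conj z * w)) ^ m else f w / mobius z w ^ m)
          =ᶠ[𝓝 z] fun w => g w * (-(1 - conj z * w)) ^ m := by
        filter_upwards [hfg, Metric.isOpen_ball.mem_nhds hz] with w hw hwd
        split_ifs with hwz
        · rfl
        · have h1 := one_sub_conj_mul_ne_zero hz hwd
          have h2 : z - w ≠ 0 := sub_ne_zero.2 (Ne.symm hwz)
          rw [hw, mobius, smul_eq_mul, div_pow, div_div_eq_mul_div, ← neg_sub z w, neg_pow (z - w),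
            neg_pow (1 - conj z * w)]
          field_simp
      refine DifferentiableAt.differentiableWithinAt ?_
      rw [heq.differentiableAt_iff]
      exact hg.differentiableAt.mul (by fun_prop)
    · have heq : (fun w => if w = a then g w * (-(1 - conj a * w)) ^ m else f w / mobius a w ^ m)
          =ᶠ[𝓝 z] fun w => f w / mobius a w ^ m := by
        filter_upwards [isOpen_ne.mem_nhds hza] with w hw
        exact if_neg hw
      refine DifferentiableAt.differentiableWithinAt ?_
      rw [heq.differentiableAt_iff]
      exact (hf.differentiableAt (Metric.isOpen_ball.mem_nhds hz)).div
        ((hasDerivAt_mobius ha hz).differentiableAt.pow m) (pow_ne_zero _ (hmob z hz hza))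
  · simp only
    split_ifs with hza
    · subst hza
      have h1 := hfg.self_of_nhds
      rw [h1, mobius]
      rcases Nat.eq_zero_or_pos m with rfl | hm
      · simp
      · simp [hm.ne']
    · rw [mul_div_cancel₀ _ (pow_ne_zero _ (hmob z hz hza))]

theorem exists_radius_of_tendsto_towardCircle {f : ℂ → ℂ}
    (h : Tendsto (fun z => ‖f z‖) towardCircle (𝓝 1)) :
    ∃ r : ℝ, 0 < r ∧ r < 1 ∧ ∀ z ∈ disk, r ≤ ‖z‖ → f z ≠ 0 := by
  have h1 : ∀ᶠ w in towardCircle, 0 < ‖f w‖ := h.eventually_const_lt one_pos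
  rw [towardCircle, eventually_comap] at h1
  obtain ⟨l, hl, hsub⟩ := (mem_nhdsLT_iff_exists_Ioo_subset' (zero_lt_one' ℝ)).1 h1
  have hl1 : l < 1 := hl
  -- A point strictly between `max l 0` and `1`, so that the radius is positive and exceeds `l`.
  refine ⟨(max l 0 + 1) / 2, ?_, ?_, fun z hz hrz => ?_⟩
  · linarith [le_max_right l 0]
  · linarith [max_lt hl1 one_pos]
  · have hz1 : ‖z‖ < 1 := by simpa using hz
    have hlz : l < ‖z‖ := by linarith [le_max_left l 0]
    exact norm_pos_iff.1 (hsub ⟨hlz, hz1⟩ z rfl)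

/-- By the identity theorem, zeros accumulating inside the disk would make `f` vanish identically,
also near the circle. -/
theorem not_eventually_zero_of_tendsto_towardCircle {f : ℂ → ℂ} (hf : DifferentiableOn ℂ f disk)
    (h : Tendsto (fun z => ‖f z‖) towardCircle (𝓝 1)) {a : ℂ} (ha : a ∈ disk) :
    ¬ ∃ᶠ z in 𝓝[≠] a, f z = 0 := by
  intro hfr
  obtain ⟨r, hr0, hr1, hr⟩ := exists_radius_of_tendsto_towardCircle h
  have hn : ‖(r : ℂ)‖ = r := by rw [Complex.norm_real, Real.norm_of_nonneg hr0.le]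
  have hrd : (r : ℂ) ∈ disk := by
    rw [mem_ball_zero_iff, hn]
    exact hr1
  exact hr r hrd hn.ge
    ((hf.analyticOnNhd Metric.isOpen_ball).eqOn_zero_of_preconnected_of_frequently_eq_zero
      (convex_ball (0 : ℂ) 1).isPreconnected ha hfr hrd)

/-- The zeros lie in a compact smaller disk, where infinitely many would accumulate. -/
theorem finite_zeros_of_tendsto_towardCircle {f : ℂ → ℂ} (hf : DifferentiableOn ℂ f disk)
    (h : Tendsto (fun z => ‖f z‖) towardCircle (𝓝 1)) : {z ∈ disk | f z = 0}.Finite := by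
  obtain ⟨r, hr0, hr1, hr⟩ := exists_radius_of_tendsto_towardCircle h
  by_contra hinf
  obtain ⟨a, ha, hacc⟩ := Set.Infinite.exists_accPt_of_subset_isCompact hinf
    (isCompact_closedBall (0 : ℂ) r) fun z hz => by
      rw [mem_closedBall_zero_iff]
      exact (not_le.1 fun hrz => hr z hz.1 hrz hz.2).le
  refine not_eventually_zero_of_tendsto_towardCircle hf h
    (Metric.closedBall_subset_ball hr1 ha) ?_
  exact (accPt_iff_frequently_nhdsNE.1 hacc).mono fun z hz => hz.2

theorem IsFiniteBlaschkeProduct.mobius_mul {f g : ℂ → ℂ} (hg : IsFiniteBlaschkeProduct g) {a : ℂ}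
    (ha : a ∈ disk) (h : ∀ z ∈ disk, f z = mobius a z * g z) : IsFiniteBlaschkeProduct f := by
  obtain ⟨n, b, c, hb, hc, hgb⟩ := hg
  refine ⟨n + 1, Fin.cons a b, c, Fin.cases ha hb, hc, fun z hz => ?_⟩
  rw [h z hz, hgb z hz, Fin.prod_univ_succ, mobius]
  simp only [Fin.cons_zero, Fin.cons_succ]
  ring

theorem IsFiniteBlaschkeProduct.mobius_pow_mul {g : ℂ → ℂ} (hg : IsFiniteBlaschkeProduct g)
    {a : ℂ} (ha : a ∈ disk) (m : ℕ) : ∀ {f : ℂ → ℂ},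
    (∀ z ∈ disk, f z = mobius a z ^ m * g z) → IsFiniteBlaschkeProduct f := by
  induction m with
  | zero =>
    intro f h
    obtain ⟨n, b, c, hb, hc, hgb⟩ := hg
    exact ⟨n, b, c, hb, hc, fun z hz => by rw [h z hz, pow_zero, one_mul, hgb z hz]⟩
  | succ m ih =>
    intro f h
    exact (ih (f := fun z => mobius a z ^ m * g z) fun _ _ => rfl).mobius_mul ha fun z hz => by
      rw [h z hz, pow_succ', mul_assoc]

/-- Induction on the number of distinct zeros: dividing by a power of a Möbius factor removes one
zero with its full multiplicity and keeps the boundary behaviour, since the factor has modulus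
tending to `1`. -/
theorem isFiniteBlaschkeProduct_of_tendsto {f : ℂ → ℂ} (hf : DifferentiableOn ℂ f disk)
    (h : Tendsto (fun z => ‖f z‖) towardCircle (𝓝 1)) : IsFiniteBlaschkeProduct f := by
  generalize hn : {z ∈ disk | f z = 0}.ncard = n
  induction n using Nat.strong_induction_on generalizing f with
  | _ n ih =>
    by_cases h0 : ∀ z ∈ disk, f z ≠ 0
    · obtain ⟨c, hc, hfc⟩ := exists_unimodular_const_of_ne_zero hf h h0
      exact ⟨0, Fin.elim0, c, fun i => i.elim0, hc, fun z hz => by simp [hfc z hz]⟩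
    push Not at h0
    obtain ⟨a, ha, hfa⟩ := h0
    obtain ⟨m, g, hg, hga, hfg⟩ := exists_eq_mobius_pow_mul hf ha fun hev =>
      not_eventually_zero_of_tendsto_towardCircle hf h ha
        (hev.filter_mono nhdsWithin_le_nhds).frequently
    have hgt : Tendsto (fun z => ‖g z‖) towardCircle (𝓝 1) := by
      have h1 := h.div ((tendsto_norm_mobius ha).pow m) (by simp)
      rw [one_pow, div_one] at h1
      refine h1.congr' ?_
      filter_upwards [eventually_towardCircle_mem_disk,
        (tendsto_norm_mobius ha).eventually_const_lt one_pos] with z hz hpos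
      rw [Pi.div_apply, hfg z hz, norm_mul, norm_pow, mul_div_cancel_left₀ _ (pow_pos hpos m).ne']
    have hlt : {z ∈ disk | g z = 0}.ncard < n := by
      rw [← hn]
      refine Set.ncard_lt_ncard ?_ (finite_zeros_of_tendsto_towardCircle hf h)
      refine ⟨fun z hz => ⟨hz.1, by rw [hfg z hz.1, hz.2, mul_zero]⟩, fun hsub => ?_⟩
      exact hga (hsub ⟨ha, hfa⟩).2
    exact (ih _ hlt hg hgt rfl).mobius_pow_mul ha m hfg

end SubBergman

/-! ### The equivalence of the four conditions -/

theorem theorem13 (α : ℝ) (hα : -1 < α) (φ : ℂ → ℂ) (hφ : SubBergman.MemHInftyBall φ)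
    (hconst : ¬ ∃ c : ℂ, ‖c‖ = 1 ∧ ∀ z ∈ SubBergman.disk, φ z = c) :
    List.TFAE [
      IsCompactOperator (SubBergman.defectOp α hφ),
      SubBergman.IsFiniteBlaschkeProduct φ,
      SubBergman.subBergman α hφ = SubBergman.genBergman (α - 1),
      SubBergman.subBergman α hφ ⊆ SubBergman.genBergman (α - 1)] := by
  tfae_have 1 → 2 := fun h => SubBergman.isFiniteBlaschkeProduct_of_tendsto hφ.differentiableOn
    (SubBergman.tendsto_norm_of_isCompactOperator_defectOp hα hφ h)
  tfae_have 2 → 3 := SubBergman.subBergman_eq_genBergman_of_blaschke hα hφ hconst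
  tfae_have 3 → 4 := fun h => h.subset
  tfae_have 4 → 1 := SubBergman.isCompactOperator_defectOp_of_subset hα hφ
  tfae_finish
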